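/- Let $N,k\ge 1$ and $\Sigma_N=\{-1,+1\}^N$, and write $R(\sigma,\tau)=\frac1N\sum_{i\le N}\sigma_i\tau_i$. Let $\xi:\mathbb R\to\mathbb R$ be a smooth convex function with $\xi(0)=0$ and $\xi'(0)=0$, and put $$\theta(x)=x\xi'(x)-\xi(x),\qquad \Delta(a,b)=\xi(a)-a\xi'(b)+\theta(b).$$ Let $0=m_0<m_1<\dots<m_k<1$ and $0=q_0<q_1<\dots<q_k<q_{k+1}=1$. On a probability space consider three mutually independent objects. (a) A centered Gaussian process $(H_N(\sigma))_{\sigma\in\Sigma_N}$ with covariance $\mathbb E H_N(\sigma)H_N(\tau)=N\xi(R(\sigma,\tau))$. (b) Derrida–Ruelle cascade: for each $1\le l\le k$ and $(n_1,\dots,n_{l-1})\in\mathbb N^{l-1}$, a decreasing enumeration $(u_{n_1\dots n_{l-1}n})_{n\in\mathbb N}$ of a Poisson point process on $(0,\infty)$ with intensity measure $x^{-1-m_l}\,dx$, all these processes being independent. For $\alpha=(n_1,\dots,n_k)\in\mathbb N^k$ let $v_\alpha=\prod_{1\le l\le k}u_{n_1\dots n_l}$ and $w_\alpha=v_\alpha/\sum_\beta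 v_\beta$. (c) Independent centered Gaussian variables $z_{i,n_1\dots n_l}$ for $1\le i\le N$, $0\le l\le k$, $(n_1,\dots,n_l)\in\mathbb N^l$, with variance $\xi'(q_{l+1})-\xi'(q_l)$. For $\alpha=(n_1,\dots,n_k)$ let $s_i^\alpha=\sum_{0\le l\le k}z_{i,n_1\dots n_l}$. For $\alpha,\beta\in\mathbb N^k$ let $\alpha\wedge\beta=\min\{l\ge1:\alpha_l\ne\beta_l\}$ if $\alpha\neq\beta$, and $\alpha\wedge\beta=k+1$ if $\alpha=\beta$. For $0\le t\le1$ let $$H_t(\sigma,\alpha)=\sqrt t\,H_N(\sigma)+\sqrt{1-t}\,\sum_{i\le N}s_i^\alpha\sigma_i,\qquad \varphi(t)=\frac1N\,\mathbb E\log\sum_{\sigma,\alpha}w_\alpha\exp H_t(\sigma,\alpha),$$ let $\Gamma=\Gamma_t$ be the (random) probability measure on $\Sigma_N\times\mathbb N^k$ with $\Gamma\{(\sigma,\alpha)\}$ proportional to $w_\alpha\exp H_t(\sigma,\alpha)$, and let $\langle\cdot\rangle$ denote the average over two points $(\sigma^1,\alpha),(\sigma^2,\beta)$ with respect to $\Gamma^{\otimes2}$;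 write $R_{1,2}=R(\sigma^1,\sigma^2)$. Then almost surely $0<\sum_\alpha v_\alpha<\infty$; for every $t\in[0,1]$, almost surely $0<\sum_{\sigma,\alpha}w_\alpha\exp H_t(\sigma,\alpha)<\infty$; all the expectations in $\varphi(t)$ and in the formula below are of integrable variables; and $\varphi$ is differentiable on $[0,1]$ (one-sidedly at the endpoints) with $$\varphi'(t)=-\tfrac12\theta(1)+\tfrac12\,\mathbb E\bigl\langle\theta(q_{\alpha\wedge\beta})\bigr\rangle-\tfrac12\,\mathbb E\bigl\langle\Delta(R_{1,2},q_{\alpha\wedge\beta})\bigr\rangle .$$ -/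

import Mathlib

open MeasureTheory ProbabilityTheory Set
open scoped NNReal ENNReal

noncomputable section

/-! ### Spin configurations, overlap, and the functions `θ` and `Δ` -/

/-- The space `{-1, +1}^N` of spin configurations. -/
abbrev SpinConfig (N : ℕ) : Type := Fin N → ℤˣ

/-- The `i`-th spin as a real number. -/
def spin {N : ℕ} (σ : SpinConfig N) (i : Fin N) : ℝ := ((σ i : ℤ) : ℝ)

/-- The overlap `R(σ, τ) = N⁻¹ ∑ᵢ σᵢ τᵢ`. -/
def overlap {N : ℕ} (σ τ : SpinConfig N) : ℝ := (N : ℝ)⁻¹ * ∑ i, spin σ i * spin τ i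

/-- `θ(x) = x ξ'(x) - ξ(x)`. -/
def thetaFn (ξ : ℝ → ℝ) (x : ℝ) : ℝ := x * deriv ξ x - ξ x

/-- `Δ(a, b) = ξ(a) - a ξ'(b) + θ(b)`. -/
def deltaFn (ξ : ℝ → ℝ) (a b : ℝ) : ℝ := ξ a - a * deriv ξ b + thetaFn ξ b

/-- `H` is a centered Gaussian process on `{-1, +1}^N` with covariance
`E H(σ) H(τ) = N ξ(R(σ, τ))`. -/
structure IsGaussianHamiltonian {Ω : Type*} [MeasurableSpace Ω] (P : Measure Ω) {N : ℕ}
    (ξ : ℝ → ℝ) (H : SpinConfig N → Ω → ℝ) : Prop where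
  measurable : ∀ σ, Measurable (H σ)
  gaussian : HasGaussianLaw (fun ω σ => H σ ω) P
  mean_zero : ∀ σ, ∫ ω, H σ ω ∂P = 0
  covariance : ∀ σ τ, ∫ ω, H σ ω * H τ ω ∂P = N * ξ (overlap σ τ)

/-! ### Poisson point processes -/

/-- The number of points of the family `X` that lie in `A`, counted with multiplicity. -/
def pointCount {Ω ι E : Type*} (X : ι → Ω → E) (A : Set E) (ω : Ω) : ℕ∞ :=
  {i | X i ω ∈ A}.encard

/-- The random points `X i` form a Poisson point process with intensity measure `μ`: the number
of points in a measurable set `A` is Poisson distributed with mean `μ A` (infinite almost surely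
if `μ A = ∞`), and the numbers of points in disjoint sets are independent. -/
structure IsPoissonProcess {Ω ι E : Type*} [MeasurableSpace Ω] [MeasurableSpace E]
    (P : Measure Ω) (μ : Measure E) (X : ι → Ω → E) : Prop where
  measurable : ∀ i, Measurable (X i)
  law_of_finite : ∀ A, MeasurableSet A → μ A ≠ ∞ →
    HasLaw (pointCount X A) ((poissonMeasure (μ A).toNNReal).map ((↑) : ℕ → ℕ∞)) P
  law_of_infinite : ∀ A, MeasurableSet A → μ A = ∞ → ∀ᵐ ω ∂P, pointCount X A ω = ⊤
  indep : ∀ (r : ℕ) (A : Fin r → Set E), (∀ j, MeasurableSet (A j)) →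
    Pairwise (fun i j => Disjoint (A i) (A j)) → iIndepFun (fun j => pointCount X (A j)) P

/-- The measure `x^(-1-m) dx` on `(0, ∞)`, viewed as a measure on `ℝ`. -/
def powerIntensity (m : ℝ) : Measure ℝ :=
  (volume.restrict (Ioi 0)).withDensity fun x => ENNReal.ofReal (x ^ (-1 - m))

/-- `u 0 ≥ u 1 ≥ ...` is a decreasing enumeration of a Poisson point process on `(0, ∞)` with
intensity measure `x^(-1-m) dx`. -/
structure IsDecreasingPoissonEnumeration {Ω : Type*} [MeasurableSpace Ω]
    (P : Measure Ω) (m : ℝ) (u : ℕ → Ω → ℝ) : Prop where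
  poisson : IsPoissonProcess P (powerIntensity m) u
  pos : ∀ᵐ ω ∂P, ∀ n, 0 < u n ω
  decreasing : ∀ᵐ ω ∂P, Antitone fun n => u n ω

/-! ### The tree `ℕ^k` and the cascades

The vertices at level `l` of the tree are the elements of `Fin l → ℕ`; the leaves are the
elements `α : Fin k → ℕ`, and the coordinate `α_l` (`1 ≤ l ≤ k`) of a leaf is `α ⟨l - 1, _⟩`. -/

/-- The first `l` coordinates of a leaf. -/
def leafPrefix {k : ℕ} (α : Fin k → ℕ) (l : ℕ) (hl : l ≤ k) : Fin l → ℕ :=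
  fun j => α (Fin.castLE hl j)

/-- `α ∧ β = min {l ≥ 1 : α_l ≠ β_l}` if `α ≠ β`, and `k + 1` if `α = β`. -/
def treeMeet {k : ℕ} (α β : Fin k → ℕ) : ℕ :=
  if α = β then k + 1 else sInf {l : ℕ | ∃ j : Fin k, α j ≠ β j ∧ l = (j : ℕ) + 1}

/-- The point processes of the Derrida-Ruelle cascade with parameters `m 1 < ... < m k`:
`u l a n` is the point `u_{n₁ ... n_l n}` with `a = (n₁, ..., n_l)`, for `0 ≤ l < k`.  For every
vertex `a` of level `l` the sequence `u l a` is a decreasing enumeration of a Poisson process of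
intensity `x^(-1-m (l+1)) dx`, and all these sequences are independent. -/
structure IsCascade {Ω : Type*} [MeasurableSpace Ω] (P : Measure Ω) {k : ℕ} (m : ℕ → ℝ)
    (u : (l : Fin k) → (Fin l → ℕ) → ℕ → Ω → ℝ) : Prop where
  poisson : ∀ (l : Fin k) (a : Fin l → ℕ),
    IsDecreasingPoissonEnumeration P (m ((l : ℕ) + 1)) (u l a)
  indep : iIndepFun (fun (a : (l : Fin k) × (Fin l → ℕ)) ω n => u a.1 a.2 n ω) P

/-- `v_α = ∏_{1 ≤ l ≤ k} u_{n₁ ... n_l}` for `α = (n₁, ..., n_k)`. -/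
def cascadeProd {Ω : Type*} {k : ℕ} (u : (l : Fin k) → (Fin l → ℕ) → ℕ → Ω → ℝ)
    (α : Fin k → ℕ) (ω : Ω) : ℝ :=
  ∏ l : Fin k, u l (leafPrefix α l l.isLt.le) (α l) ω

/-- `w_α = v_α / ∑_β v_β`. -/
def cascadeWeight {Ω : Type*} {k : ℕ} (u : (l : Fin k) → (Fin l → ℕ) → ℕ → Ω → ℝ)
    (α : Fin k → ℕ) (ω : Ω) : ℝ :=
  cascadeProd u α ω / ∑' β, cascadeProd u β ω

/-- The Gaussian vectors attached to the vertices of the tree: `z l a i` is the `i`-th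
coordinate of `z_{n₁ ... n_l}` with `a = (n₁, ..., n_l)`, for `0 ≤ l ≤ k` (for `l = 0` this is the
common column `z₀`).  All these variables are independent, centered Gaussian, and those at level
`l` have variance `ξ'(q (l+1)) - ξ'(q l)`. -/
structure IsTreeGaussian {Ω : Type*} [MeasurableSpace Ω] (P : Measure Ω) {N k : ℕ} (ξ : ℝ → ℝ)
    (q : ℕ → ℝ) (z : (l : Fin (k + 1)) → (Fin l → ℕ) → Fin N → Ω → ℝ) : Prop where
  measurable : ∀ l a i, Measurable (z l a i)
  law : ∀ l a i, HasLaw (z l a i)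
    (gaussianReal 0 (deriv ξ (q ((l : ℕ) + 1)) - deriv ξ (q (l : ℕ))).toNNReal) P
  indep : iIndepFun
    (fun (x : ((l : Fin (k + 1)) × (Fin l → ℕ)) × Fin N) => z x.1.1 x.1.2 x.2) P

/-- `s_i^α = ∑_{0 ≤ l ≤ k} z_{i l}^α`, the sum along the path from the root to the leaf `α`. -/
def pathSum {Ω : Type*} {N k : ℕ} (z : (l : Fin (k + 1)) → (Fin l → ℕ) → Fin N → Ω → ℝ)
    (α : Fin k → ℕ) (i : Fin N) (ω : Ω) : ℝ :=
  ∑ l : Fin (k + 1), z l (leafPrefix α l (Nat.lt_succ_iff.mp l.isLt)) i ω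

/-! ### The interpolation and its Gibbs measure -/

section Interpolation

variable {Ω : Type*} {N k : ℕ} (H : SpinConfig N → Ω → ℝ)
  (u : (l : Fin k) → (Fin l → ℕ) → ℕ → Ω → ℝ)
  (z : (l : Fin (k + 1)) → (Fin l → ℕ) → Fin N → Ω → ℝ)

/-- `H_t(σ, α) = √t H(σ) + √(1 - t) s^α · σ`. -/
def interpHamiltonian (t : ℝ) (σ : SpinConfig N) (α : Fin k → ℕ) (ω : Ω) : ℝ :=
  √t * H σ ω + √(1 - t) * ∑ i, pathSum z α i ω * spin σ i

/-- The unnormalized Gibbs weight `w_α exp H_t(σ, α)`. -/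
def boltzmannWeight (t : ℝ) (x : SpinConfig N × (Fin k → ℕ)) (ω : Ω) : ℝ :=
  cascadeWeight u x.2 ω * Real.exp (interpHamiltonian H z t x.1 x.2 ω)

/-- The partition function `∑_{σ, α} w_α exp H_t(σ, α)`. -/
def partitionFn (t : ℝ) (ω : Ω) : ℝ := ∑' x, boltzmannWeight H u z t x ω

/-- The mass `Γ{(σ, α)}` that the Gibbs measure `Γ` gives to a point. -/
def gibbsWeight (t : ℝ) (x : SpinConfig N × (Fin k → ℕ)) (ω : Ω) : ℝ :=
  boltzmannWeight H u z t x ω / partitionFn H u z t ω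

/-- The average `⟨f⟩` of a function `f((σ¹, α), (σ², β))` with respect to `Γ^{⊗2}`. -/
def gibbsAverage (t : ℝ)
    (f : SpinConfig N × (Fin k → ℕ) → SpinConfig N × (Fin k → ℕ) → ℝ) (ω : Ω) : ℝ :=
  ∑' p : (SpinConfig N × (Fin k → ℕ)) × (SpinConfig N × (Fin k → ℕ)),
    gibbsWeight H u z t p.1 ω * gibbsWeight H u z t p.2 ω * f p.1 p.2

/-- `φ(t) = N⁻¹ E log ∑_{σ, α} w_α exp H_t(σ, α)`. -/
def cascadeInterpolation [MeasurableSpace Ω] (P : Measure Ω) (t : ℝ) : ℝ :=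
  (N : ℝ)⁻¹ * ∫ ω, Real.log (partitionFn H u z t ω) ∂P

end Interpolation

end

open scoped Topology

noncomputable section

/-! ### Almost sure finiteness of the cascade -/

/-! The derivative formula is Gaussian interpolation on the countable set of pairs `x = (σ, α)`. The
processes `H_N(σ)` and `∑ᵢ sᵢ^α σᵢ` are independent and centered. Their covariances are `N ξ(R)` and
`N R ξ'(q_{α∧β})`; the second holds because the increments `ξ'(q_{l+1}) - ξ'(q_l)` telescope along
the common part of two branches and `ξ'(q_0) = 0`. Let `D(x, y)` be the difference of the
covariances. For fixed weights, Gaussian integration by parts turns the `t`-derivative of `E log Z`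
into `½ E⟨D(x, x)⟩ - ½ E⟨D(x, y)⟩`. Here `D = N (Δ(R, q_{α∧β}) - θ(q_{α∧β}))`, and on the diagonal
`D = N (ξ(1) - ξ'(1)) = -N θ(1)`. Dividing by `N` gives the formula.

Three analytic points remain.

Finiteness of the cascade. The sum `∑ v_α` need not have a finite mean, so fractional moments are
used. By induction on the depth, `∑ v_α^a < ∞` almost surely for every `a > m_k`. The step takes an
exponent `b` between the last two parameters and uses `(∑ x)^{b/a} ≤ ∑ x^{b/a}` together with the
bound on `E (∑ₙ uₙ^a)^{b/a}` in `exists_moment_bound`.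

Infinite index set and endpoints. The derivatives of `√t` and `√(1 - t)` blow up at 0 and 1, and
integration by parts is done for finitely many variables. The formula is therefore proved on finite
sets for `0 < t < 1`, integrated in `t`, and passed to the limit over finite subsets
(`GaussianPair.integral_log_tsum_sub`). The integrand is continuous on `[0, 1]`, so the fundamental
theorem of calculus returns the derivative, endpoints included.

Random weights. By independence the weights can be frozen while the Gaussian fields are averaged.
All bounds then depend on the weights at most through their total mass, which is the constant `2^N`,
and the Lipschitz constant in `t` does not depend on them at all. This justifies integrability and
differentiation under the outer expectation. -/

lemma ENNReal.rpow_finsetSum_le_finsetSum_rpow {ι : Type*} (s : Finset ι) (f : ι → ℝ≥0∞) {p : ℝ}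
    (hp : 0 < p) (hp1 : p ≤ 1) : (∑ i ∈ s, f i) ^ p ≤ ∑ i ∈ s, f i ^ p := by
  classical
  induction s using Finset.induction_on with
  | empty => simp [hp]
  | insert a s ha ih =>
    rw [Finset.sum_insert ha, Finset.sum_insert ha]
    exact (ENNReal.rpow_add_le_add_rpow _ _ hp.le hp1).trans (by gcongr)

lemma ENNReal.rpow_tsum_le_tsum_rpow {ι : Type*} (f : ι → ℝ≥0∞) {p : ℝ}
    (hp : 0 < p) (hp1 : p ≤ 1) : (∑' i, f i) ^ p ≤ ∑' i, f i ^ p := by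
  rw [← ENNReal.le_rpow_inv_iff hp, ENNReal.tsum_eq_iSup_sum]
  refine iSup_le fun s => ?_
  rw [ENNReal.le_rpow_inv_iff hp]
  exact (ENNReal.rpow_finsetSum_le_finsetSum_rpow s f hp hp1).trans (ENNReal.sum_le_tsum s)

lemma lintegral_natCast_poissonMeasure (r : ℝ≥0) :
    ∫⁻ n : ℕ, (n : ℝ≥0∞) ∂(poissonMeasure r) = r := by
  have h : HasSum (fun n : ℕ => Real.exp (-r) * (r : ℝ) ^ n / n.factorial * n) r := by
    rw [← hasSum_nat_add_iff' 1]
    have h1 := (hasSum_one_poissonMeasure r).mul_left (r : ℝ)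
    simp only [mul_one] at h1
    simp only [Finset.range_one, Finset.sum_singleton, Nat.cast_zero, mul_zero, sub_zero]
    refine h1.congr_fun fun n => ?_
    rw [Nat.factorial_succ]
    push_cast
    have : (n.factorial : ℝ) ≠ 0 := by positivity
    field_simp
    ring
  rw [poissonMeasure, lintegral_sum_measure]
  simp only [lintegral_smul_measure, lintegral_dirac, smul_eq_mul]
  have h2 : ∀ n : ℕ, ENNReal.ofReal (Real.exp (-r) * (r : ℝ) ^ n / n.factorial) * (n : ℝ≥0∞)
      = ENNReal.ofReal (Real.exp (-r) * (r : ℝ) ^ n / n.factorial * n) := fun n => by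
    rw [ENNReal.ofReal_mul (by positivity), ENNReal.ofReal_natCast]
  simp only [h2]
  rw [← ENNReal.ofReal_tsum_of_nonneg (fun n => by positivity) h.summable, h.tsum_eq,
    ENNReal.ofReal_coe_nnreal]

/-- By Tonelli the expected number of points in `A` is the sum of the probabilities of `X i ∈ A`,
and the Poisson law makes it `μ A`. Asking only for an upper bound makes sets of infinite intensity
trivial. -/
lemma IsPoissonProcess.sum_map_le {Ω ι E : Type*} [MeasurableSpace Ω] [MeasurableSpace E]
    [Countable ι] {P : Measure Ω} {μ : Measure E} {X : ι → Ω → E}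
    (h : IsPoissonProcess P μ X) : Measure.sum (fun i => P.map (X i)) ≤ μ := by
  refine Measure.le_iff.2 fun A hA => ?_
  by_cases hμ : μ A = ∞
  · simp [hμ]
  have hlaw := h.law_of_finite A hA hμ
  have hcount : ∀ ω, ((pointCount X A ω : ℕ∞) : ℝ≥0∞) =
      ∑' i, (X i ⁻¹' A).indicator (1 : Ω → ℝ≥0∞) ω := fun ω => by
    rw [pointCount, ← ENNReal.tsum_set_one, tsum_subtype {i | X i ω ∈ A} (fun _ => (1 : ℝ≥0∞))]
    rfl
  have key : ∫⁻ ω, ((pointCount X A ω : ℕ∞) : ℝ≥0∞) ∂P = μ A := by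
    have := hlaw.lintegral_comp (f := fun n : ℕ∞ => (n : ℝ≥0∞)) (Measurable.of_discrete).aemeasurable
    rw [this, lintegral_map Measurable.of_discrete Measurable.of_discrete]
    simp only [ENat.toENNReal_coe]
    rw [lintegral_natCast_poissonMeasure, ENNReal.coe_toNNReal hμ]
  rw [← key]
  simp only [hcount]
  rw [lintegral_tsum fun i => (measurable_one.indicator (h.measurable i hA)).aemeasurable,
    Measure.sum_apply _ hA]
  refine ENNReal.tsum_le_tsum fun i => ?_
  rw [lintegral_indicator_one (h.measurable i hA), Measure.map_apply (h.measurable i) hA]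

lemma IsPoissonProcess.lintegral_tsum_le {Ω ι E : Type*} [MeasurableSpace Ω] [MeasurableSpace E]
    [Countable ι] {P : Measure Ω} {μ : Measure E} {X : ι → Ω → E}
    (h : IsPoissonProcess P μ X) {f : E → ℝ≥0∞} (hf : Measurable f) :
    ∫⁻ ω, ∑' i, f (X i ω) ∂P ≤ ∫⁻ x, f x ∂μ := by
  rw [lintegral_tsum (f := fun i ω => f (X i ω)) fun i => (hf.comp (h.measurable i)).aemeasurable]
  refine le_trans (le_of_eq ?_) (lintegral_mono' h.sum_map_le le_rfl)
  rw [lintegral_sum_measure]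
  exact tsum_congr fun i => (lintegral_map hf (h.measurable i)).symm

lemma lintegral_powerIntensity (m : ℝ) {f : ℝ → ℝ≥0∞} (hf : Measurable f) :
    ∫⁻ x, f x ∂(powerIntensity m) = ∫⁻ x in Ioi 0, ENNReal.ofReal (x ^ (-1 - m)) * f x := by
  rw [powerIntensity, lintegral_withDensity_eq_lintegral_mul _ (by fun_prop) hf]
  rfl

lemma setLIntegral_rpow_powerIntensity {m a : ℝ} {s : Set ℝ} (hs : MeasurableSet s)
    (h0 : s ⊆ Ioi 0) (hint : IntegrableOn (fun x : ℝ => x ^ (a - 1 - m)) s) :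
    ∫⁻ x, s.indicator (fun x => ENNReal.ofReal (x ^ a)) x ∂(powerIntensity m) < ∞ := by
  rw [lintegral_powerIntensity m ((by fun_prop : Measurable _).indicator hs)]
  calc _ = ∫⁻ x in s, ENNReal.ofReal (x ^ (a - 1 - m)) := by
        rw [← lintegral_indicator measurableSet_Ioi, ← lintegral_indicator hs]
        refine lintegral_congr fun x => ?_
        by_cases hx : x ∈ s
        · have hx0 : 0 < x := h0 hx
          simp only [indicator_of_mem hx, indicator_of_mem (h0 hx)]
          rw [← ENNReal.ofReal_mul (by positivity), ← Real.rpow_add hx0]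
          ring_nf
        · simp [indicator_of_notMem hx]
    _ < ∞ := hint.lintegral_lt_top

/-- The points are split at 1. Below 1, `∑ uₙ^a` has finite mean because `a > m`. Above 1 the
intensity has a heavy tail; subadditivity of the power `b/a` replaces `uₙ^a` by `uₙ^b`, whose sum
has finite mean because `b < m`. The constant is the same for all vertices of a level. -/
lemma exists_moment_bound {m a b : ℝ} (hb : 0 < b) (hbm : b < m) (hma : m < a) :
    ∃ C : ℝ≥0∞, C ≠ ∞ ∧ ∀ {Ω : Type*} [MeasurableSpace Ω] (P : Measure Ω) [IsProbabilityMeasure P]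
      (u : ℕ → Ω → ℝ), IsDecreasingPoissonEnumeration P m u →
      ∫⁻ ω, (∑' n, ENNReal.ofReal (u n ω ^ a)) ^ (b / a) ∂P ≤ C := by
  have ha : 0 < a := by linarith
  set f₁ : ℝ → ℝ≥0∞ := (Ioc 0 1).indicator (fun x => ENNReal.ofReal (x ^ a)) with hf₁
  set f₂ : ℝ → ℝ≥0∞ := (Ioi 1).indicator (fun x => ENNReal.ofReal (x ^ b)) with hf₂
  have hm₁ : Measurable f₁ := (by fun_prop : Measurable _).indicator measurableSet_Ioc
  have hm₂ : Measurable f₂ := (by fun_prop : Measurable _).indicator measurableSet_Ioi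
  refine ⟨1 + ∫⁻ x, f₁ x ∂(powerIntensity m) + ∫⁻ x, f₂ x ∂(powerIntensity m), ?_, ?_⟩
  · have h1 : ∫⁻ x, f₁ x ∂(powerIntensity m) < ∞ := by
      refine setLIntegral_rpow_powerIntensity measurableSet_Ioc (fun x hx => hx.1) ?_
      exact (intervalIntegrable_iff_integrableOn_Ioc_of_le zero_le_one).1
        (intervalIntegral.intervalIntegrable_rpow' (by linarith))
    have h2 : ∫⁻ x, f₂ x ∂(powerIntensity m) < ∞ := by
      refine setLIntegral_rpow_powerIntensity measurableSet_Ioi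
        (fun x hx => lt_trans zero_lt_one (mem_Ioi.1 hx)) ?_
      exact integrableOn_Ioi_rpow_of_lt (by linarith) zero_lt_one
    simp [h1.ne, h2.ne]
  intro Ω _ P _ u hu
  have hpw : ∀ᵐ ω ∂P, (∑' n, ENNReal.ofReal (u n ω ^ a)) ^ (b / a)
      ≤ 1 + ∑' n, f₁ (u n ω) + ∑' n, f₂ (u n ω) := by
    filter_upwards [hu.pos] with ω hω
    have hp0 : 0 < b / a := by positivity
    have hp1 : b / a ≤ 1 := (div_le_one ha).2 (by linarith)
    have hsplit : ∑' n, ENNReal.ofReal (u n ω ^ a) = ∑' n, f₁ (u n ω)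
        + ∑' n, (Ioi 1).indicator (fun x : ℝ => ENNReal.ofReal (x ^ a)) (u n ω) := by
      rw [← ENNReal.tsum_add]
      refine tsum_congr fun n => ?_
      rcases le_or_gt (u n ω) 1 with h | h
      · rw [hf₁, indicator_of_mem (show u n ω ∈ Ioc 0 1 from ⟨hω n, h⟩),
          indicator_of_notMem (by simpa using h), add_zero]
      · rw [hf₁, indicator_of_notMem (by simp [h]), indicator_of_mem (by exact h), zero_add]
    rw [hsplit]
    refine (ENNReal.rpow_add_le_add_rpow _ _ hp0.le hp1).trans ?_
    gcongr
    -- For an exponent `p ≤ 1`, `s^p ≤ 1 + s`.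
    · rcases le_total (∑' n, f₁ (u n ω)) 1 with h | h
      · exact (ENNReal.rpow_le_one h hp0.le).trans le_self_add
      · calc _ ≤ (∑' n, f₁ (u n ω)) ^ (1 : ℝ) := ENNReal.rpow_le_rpow_of_exponent_le h hp1
          _ ≤ _ := by rw [ENNReal.rpow_one]; exact le_add_self
    · refine (ENNReal.rpow_tsum_le_tsum_rpow _ hp0 hp1).trans (ENNReal.tsum_le_tsum fun n => ?_)
      by_cases h : u n ω ∈ Ioi 1
      · rw [hf₂, indicator_of_mem h, indicator_of_mem h,
          ENNReal.ofReal_rpow_of_nonneg (Real.rpow_nonneg (hω n).le _) hp0.le,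
          ← Real.rpow_mul (hω n).le, mul_div_cancel₀ _ ha.ne']
      · rw [indicator_of_notMem h, ENNReal.zero_rpow_of_pos hp0]; exact zero_le
  refine (lintegral_mono_ae hpw).trans ?_
  have hmu := hu.poisson.measurable
  rw [lintegral_add_right _ (by fun_prop), lintegral_add_right _ (by fun_prop)]
  simp only [lintegral_const, measure_univ, mul_one]
  gcongr
  · exact hu.poisson.lintegral_tsum_le hm₁
  · exact hu.poisson.lintegral_tsum_le hm₂

/-- If `∑ xᵢ < ∞` a.s. and `yᵢ` is independent of all the `xⱼ` with bounded expectation, then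
`∑ xᵢ yᵢ < ∞` a.s. -/
lemma ae_tsum_mul_lt_top {Ω ι : Type*} [Countable ι] {m₁ m₂ mΩ : MeasurableSpace Ω} {P : Measure Ω}
    [IsProbabilityMeasure P] (h₁ : m₁ ≤ mΩ) (h₂ : m₂ ≤ mΩ)
    (hind : Indep m₁ m₂ P) {x y : ι → Ω → ℝ≥0∞} (hx : ∀ i, Measurable[m₁] (x i))
    (hy : ∀ i, Measurable[m₂] (y i)) {C : ℝ≥0∞} (hC : C ≠ ∞) (hyC : ∀ i, ∫⁻ ω, y i ω ∂P ≤ C)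
    (hfin : ∀ᵐ ω ∂P, ∑' i, x i ω < ∞) : ∀ᵐ ω ∂P, ∑' i, x i ω * y i ω < ∞ := by
  have hX : Measurable[m₁] fun ω => ∑' i, x i ω :=
    @Measurable.tsum Ω _ ι m₁ _ _ _ _ _ _ _ _ _ _ _ _ hx
  have hset : ∀ K : ℕ, MeasurableSet[m₁] {ω | ∑' i, x i ω ≤ K} := fun K =>
    measurableSet_le hX measurable_const
  -- `∑ xᵢ` need not be integrable. Truncation to the event `∑ xᵢ ≤ K` is `m₁`-measurable, so it
  -- preserves independence from the `yᵢ` and bounds the expectation by `C K`.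
  have hK : ∀ K : ℕ, ∀ᵐ ω ∂P, ω ∈ {ω | ∑' i, x i ω ≤ K} → ∑' i, x i ω * y i ω < ∞ := by
    intro K
    have hbound : ∫⁻ ω, ∑' i, {ω | ∑' i, x i ω ≤ K}.indicator (x i) ω * y i ω ∂P ≤ C * K := by
      have hmx : ∀ i, Measurable[m₁] ({ω | ∑' i, x i ω ≤ K}.indicator (x i)) := fun i =>
        (hx i).indicator (hset K)
      rw [lintegral_tsum (f := fun i ω => {ω | ∑' i, x i ω ≤ K}.indicator (x i) ω * y i ω) fun i =>
        (((hmx i).mono h₁ le_rfl).mul ((hy i).mono h₂ le_rfl)).aemeasurable]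
      calc ∑' i, ∫⁻ ω, {ω | ∑' i, x i ω ≤ K}.indicator (x i) ω * y i ω ∂P
          ≤ ∑' i, C * ∫⁻ ω, {ω | ∑' i, x i ω ≤ K}.indicator (x i) ω ∂P := by
            refine ENNReal.tsum_le_tsum fun i => ?_
            rw [lintegral_mul_eq_lintegral_mul_lintegral_of_independent_measurableSpace h₁ h₂ hind
              (hmx i) (hy i), mul_comm]
            gcongr
            exact hyC i
        _ = C * ∫⁻ ω, ∑' i, {ω | ∑' i, x i ω ≤ K}.indicator (x i) ω ∂P := by
            rw [ENNReal.tsum_mul_left, lintegral_tsum fun i =>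
              ((hmx i).mono h₁ le_rfl).aemeasurable]
        _ ≤ C * ∫⁻ _, (K : ℝ≥0∞) ∂P := by
            gcongr with ω
            by_cases hω : ω ∈ {ω | ∑' i, x i ω ≤ K}
            · simp only [indicator_of_mem hω]; exact hω
            · simp [indicator_of_notMem hω]
        _ = C * K := by simp
    have hlt : ∫⁻ ω, ∑' i, {ω | ∑' i, x i ω ≤ K}.indicator (x i) ω * y i ω ∂P ≠ ∞ :=
      ne_top_of_le_ne_top (ENNReal.mul_ne_top hC (ENNReal.natCast_ne_top K)) hbound
    have hmeas : Measurable fun ω => ∑' i, {ω | ∑' i, x i ω ≤ K}.indicator (x i) ω * y i ω :=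
      Measurable.tsum fun i =>
        (((hx i).indicator (hset K)).mono h₁ le_rfl).mul ((hy i).mono h₂ le_rfl)
    filter_upwards [ae_lt_top hmeas hlt] with ω hω hmem
    refine lt_of_eq_of_lt (tsum_congr fun i => ?_) hω
    rw [indicator_of_mem (show ω ∈ {ω | ∑' i, x i ω ≤ K} from hmem)]
  filter_upwards [ae_all_iff.2 hK, hfin] with ω hω hf
  obtain ⟨K, hK⟩ := ENNReal.exists_nat_gt hf.ne
  exact hω K hK.le

lemma IsCascade.init {Ω : Type*} [MeasurableSpace Ω] {P : Measure Ω} {k : ℕ} {m : ℕ → ℝ}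
    {u : (l : Fin (k + 1)) → (Fin l → ℕ) → ℕ → Ω → ℝ} (hu : IsCascade P m u) :
    IsCascade P m (fun l : Fin k => u l.castSucc) where
  poisson l a := hu.poisson l.castSucc a
  indep := hu.indep.precomp
    (g := fun a : (l : Fin k) × (Fin l → ℕ) => (⟨a.1.castSucc, a.2⟩ :
      (l : Fin (k + 1)) × (Fin l → ℕ))) (by
        rintro ⟨l, a⟩ ⟨l', a'⟩ h
        obtain ⟨h1, h2⟩ := Sigma.mk.inj_iff.1 h
        have : l = l' := Fin.castSucc_injective _ h1
        subst this
        simpa using h2)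

lemma cascadeProd_snoc {Ω : Type*} {k : ℕ} (u : (l : Fin (k + 1)) → (Fin l → ℕ) → ℕ → Ω → ℝ)
    (α : Fin k → ℕ) (n : ℕ) (ω : Ω) :
    cascadeProd u (Fin.snoc (α := fun _ => ℕ) α n) ω =
      cascadeProd (fun l : Fin k => u l.castSucc) α ω * u (Fin.last k) α n ω := by
  have hpre : ∀ (l : ℕ) (h : l ≤ k), leafPrefix (Fin.snoc (α := fun _ => ℕ) α n : Fin (k + 1) → ℕ)
      l (h.trans k.le_succ) = leafPrefix α l h := fun l h => by
    funext j
    exact Fin.snoc_castSucc (α := fun _ => ℕ) n α (Fin.castLE h j)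
  rw [cascadeProd, Fin.prod_univ_castSucc, cascadeProd]
  congr 1
  · refine Finset.prod_congr rfl fun l _ => ?_
    rw [Fin.snoc_castSucc]
    exact congrArg (fun a => u l.castSucc a (α l) ω) (hpre l l.isLt.le)
  · rw [Fin.snoc_last]
    exact congrArg (fun a => u (Fin.last k) a n ω) (hpre k le_rfl)

lemma IsCascade.ae_pos {Ω : Type*} [MeasurableSpace Ω] {P : Measure Ω} {k : ℕ} {m : ℕ → ℝ}
    {u : (l : Fin k) → (Fin l → ℕ) → ℕ → Ω → ℝ} (hu : IsCascade P m u) :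
    ∀ᵐ ω ∂P, ∀ l a n, 0 < u l a n ω :=
  ae_all_iff.2 fun l => ae_all_iff.2 fun a => (hu.poisson l a).pos

lemma IsCascade.measurable {Ω : Type*} [MeasurableSpace Ω] {P : Measure Ω} {k : ℕ} {m : ℕ → ℝ}
    {u : (l : Fin k) → (Fin l → ℕ) → ℕ → Ω → ℝ} (hu : IsCascade P m u) (l : Fin k)
    (a : Fin l → ℕ) (n : ℕ) : Measurable (u l a n) :=
  (hu.poisson l a).poisson.measurable n

/-- Induction on the depth; a general exponent `a` is needed because the step applies the hypothesis
with another one. For `m k < b < m (k+1)`, `(∑ v^a)^{b/a}` is at most the sum over vertices of level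
`k` of `v^b (∑ₙ uₙ^a)^{b/a}`. The first factors are summable by induction, and the second ones are
independent of them with bounded mean. -/
theorem IsCascade.ae_tsum_rpow_lt_top {Ω : Type*} [MeasurableSpace Ω] {P : Measure Ω}
    [IsProbabilityMeasure P] {k : ℕ} {m : ℕ → ℝ} (hm0 : m 0 = 0) (hm : ∀ l < k, m l < m (l + 1))
    {u : (l : Fin k) → (Fin l → ℕ) → ℕ → Ω → ℝ} (hu : IsCascade P m u) {a : ℝ} (ha : m k < a) :
    ∀ᵐ ω ∂P, ∑' α, ENNReal.ofReal (cascadeProd u α ω ^ a) < ∞ := by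
  induction k generalizing a with
  | zero => exact .of_forall fun ω => by simp
  | succ k ih =>
    have hmk : m k < m (k + 1) := hm k k.lt_succ_self
    have hk0 : 0 ≤ m k := by
      have : ∀ l ≤ k, 0 ≤ m l := fun l hl => by
        induction l with
        | zero => exact hm0.ge
        | succ l ihl => exact (ihl (by omega)).trans (hm l (by omega)).le
      exact this k le_rfl
    obtain ⟨b, hkb, hbk⟩ := exists_between hmk
    have hb0 : 0 < b := hk0.trans_lt hkb
    have ha0 : 0 < a := by linarith
    obtain ⟨C, hC, hmom⟩ := exists_moment_bound hb0 hbk ha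
    have hIH := ih (fun l hl => hm l (by omega)) hu.init hkb
    let mm : ((l : Fin (k + 1)) × (Fin l → ℕ)) → MeasurableSpace Ω := fun i =>
      MeasurableSpace.comap (fun ω n => u i.1 i.2 n ω) inferInstance
    have hmm : ∀ i, mm i ≤ ‹MeasurableSpace Ω› := fun i =>
      (measurable_pi_lambda _ fun n => hu.measurable i.1 i.2 n).comap_le
    -- The last level generates a σ-algebra independent of the one generated by all earlier levels.
    have hdisj : Disjoint {i : (l : Fin (k + 1)) × (Fin l → ℕ) | i.1 ≠ Fin.last k}
        {i | i.1 = Fin.last k} := by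
      rw [Set.disjoint_left]; intro i h1 h2; exact h1 h2
    have hind := indep_iSup_of_disjoint hmm hu.indep hdisj
    have hmeas : ∀ (S : Set ((l : Fin (k + 1)) × (Fin l → ℕ))) (i) (_ : i ∈ S) (n),
        Measurable[⨆ i ∈ S, mm i] (u i.1 i.2 n) := fun S i hi n => by
      have h1 : Measurable[mm i] (fun ω n => u i.1 i.2 n ω) := comap_measurable _
      have h2 : Measurable[mm i] (u i.1 i.2 n) := (measurable_pi_apply n).comp h1
      exact h2.mono (le_iSup₂ (f := fun i _ => mm i) i hi) le_rfl
    have key := ae_tsum_mul_lt_top (P := P) (iSup₂_le fun i _ => hmm i) (iSup₂_le fun i _ => hmm i)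
      hind
      (x := fun (α : Fin k → ℕ) ω =>
        ENNReal.ofReal (cascadeProd (fun l : Fin k => u l.castSucc) α ω ^ b))
      (y := fun (α : Fin k → ℕ) ω =>
        (∑' n, ENNReal.ofReal (u (Fin.last k) α n ω ^ a)) ^ (b / a))
      (fun α => by
        have h1 : Measurable[⨆ i ∈ {i : (l : Fin (k + 1)) × (Fin l → ℕ) | i.1 ≠ Fin.last k}, mm i]
            (cascadeProd (fun l : Fin k => u l.castSucc) α) :=
          Finset.measurable_fun_prod _ fun l _ =>
            hmeas _ ⟨l.castSucc, leafPrefix α l l.isLt.le⟩ (Fin.castSucc_ne_last l) (α l)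
        exact (h1.pow_const b).ennreal_ofReal)
      (fun α => by
        have h1 : ∀ n, Measurable[⨆ i ∈ {i : (l : Fin (k + 1)) × (Fin l → ℕ) | i.1 = Fin.last k},
            mm i] (fun ω => ENNReal.ofReal (u (Fin.last k) α n ω ^ a)) := fun n =>
          ((hmeas {i | i.1 = Fin.last k} ⟨Fin.last k, α⟩ rfl n).pow_const a).ennreal_ofReal
        exact (@Measurable.tsum Ω _ ℕ (_) _ _ _ _ _ _ _ _ _ _ _ _ h1).pow_const _)
      hC (fun α => hmom P _ (hu.poisson (Fin.last k) α)) hIH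
    filter_upwards [key, hu.ae_pos] with ω hω hpos
    have hp0 : 0 < b / a := by positivity
    have hp1 : b / a ≤ 1 := (div_le_one ha0).2 (by linarith)
    have hprod : ∀ α, 0 < cascadeProd (fun l : Fin k => u l.castSucc) α ω := fun α =>
      Finset.prod_pos fun l _ => hpos _ _ _
    have hsum : ∑' α, ENNReal.ofReal (cascadeProd u α ω ^ a) = ∑' α : Fin k → ℕ,
        ENNReal.ofReal (cascadeProd (fun l : Fin k => u l.castSucc) α ω ^ a) *
          ∑' n, ENNReal.ofReal (u (Fin.last k) α n ω ^ a) := by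
      rw [← (Fin.snocEquiv fun _ : Fin (k + 1) => ℕ).tsum_eq, ENNReal.tsum_prod', ENNReal.tsum_comm]
      refine tsum_congr fun α => ?_
      rw [← ENNReal.tsum_mul_left]
      refine tsum_congr fun n => ?_
      rw [← ENNReal.ofReal_mul (Real.rpow_nonneg (hprod α).le _),
        ← Real.mul_rpow (hprod α).le (hpos _ _ _).le, ← cascadeProd_snoc]
      rfl
    rw [hsum, ← ENNReal.rpow_lt_top_iff_of_pos hp0]
    refine (ENNReal.rpow_tsum_le_tsum_rpow _ hp0 hp1).trans_lt
      (lt_of_eq_of_lt (tsum_congr fun α => ?_) hω)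
    rw [ENNReal.mul_rpow_of_nonneg _ _ hp0.le,
      ENNReal.ofReal_rpow_of_nonneg (Real.rpow_nonneg (hprod α).le _) hp0.le,
      ← Real.rpow_mul (hprod α).le, mul_div_cancel₀ _ ha0.ne']

/-- The total mass of the cascade is almost surely positive and finite. -/
theorem IsCascade.ae_summable {Ω : Type*} [MeasurableSpace Ω] {P : Measure Ω}
    [IsProbabilityMeasure P] {k : ℕ} {m : ℕ → ℝ} (hm0 : m 0 = 0) (hm : ∀ l < k, m l < m (l + 1))
    (hmk : m k < 1) {u : (l : Fin k) → (Fin l → ℕ) → ℕ → Ω → ℝ} (hu : IsCascade P m u) :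
    ∀ᵐ ω ∂P, (∀ α, 0 < cascadeProd u α ω) ∧ Summable (fun α => cascadeProd u α ω) ∧
      0 < ∑' α, cascadeProd u α ω := by
  filter_upwards [hu.ae_tsum_rpow_lt_top hm0 hm hmk, hu.ae_pos] with ω hω hpos
  have hprod : ∀ α, 0 < cascadeProd u α ω := fun α => Finset.prod_pos fun l _ => hpos _ _ _
  have hs : Summable (fun α => cascadeProd u α ω) := by
    have := ENNReal.summable_toReal hω.ne
    simpa [ENNReal.toReal_ofReal (hprod _).le] using this
  exact ⟨hprod, hs, hs.tsum_pos (fun α => (hprod α).le) (fun _ => 0) (hprod _)⟩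

/-! ### Gaussian integration by parts -/

lemma hasDerivAt_gaussianPDFReal {v : ℝ≥0} (hv : v ≠ 0) (x : ℝ) :
    HasDerivAt (gaussianPDFReal 0 v) (-(x / v) * gaussianPDFReal 0 v x) x := by
  have hv' : (v : ℝ) ≠ 0 := by exact_mod_cast hv
  have h : HasDerivAt (fun x : ℝ => -(x - 0) ^ 2 / (2 * v)) (-(x / v)) x := by
    have := (((hasDerivAt_id x).sub_const 0).pow 2).neg.div_const (2 * (v : ℝ))
    convert! this using 1
    simp
    field_simp
  have := h.exp.const_mul ((√(2 * Real.pi * v))⁻¹)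
  convert! this using 1
  rw [gaussianPDFReal_def]
  ring

/-- The density satisfies `p' = -(x/v) p`, so this is integration by parts on the line. -/
lemma integral_id_mul_gaussianReal {v : ℝ≥0} (hv : v ≠ 0) {f f' : ℝ → ℝ}
    (hf : ∀ x, HasDerivAt f (f' x) x) (hf'm : Measurable f') {K : ℝ} (hfK : ∀ x, |f x| ≤ K)
    (hfK' : ∀ x, |f' x| ≤ K) :
    ∫ x, x * f x ∂(gaussianReal 0 v) = v * ∫ x, f' x ∂(gaussianReal 0 v) := by
  have hv' : (v : ℝ) ≠ 0 := by exact_mod_cast hv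
  have hfm : Continuous f := continuous_iff_continuousAt.2 fun x => (hf x).continuousAt
  have hp := integrable_gaussianPDFReal 0 v
  have hxp : Integrable (fun x => x * gaussianPDFReal 0 v x) := by
    have := (integrable_mul_exp_neg_mul_sq (b := 1 / (2 * v)) (by positivity)).const_mul
      ((√(2 * Real.pi * v))⁻¹)
    refine this.congr (.of_forall fun x => ?_)
    simp only [gaussianPDFReal_def, sub_zero]
    rw [show -(1 / (2 * (v : ℝ))) * x ^ 2 = -x ^ 2 / (2 * v) by ring]
    ring
  have key := integral_mul_deriv_eq_deriv_mul_of_integrable (fun x _ => hf x)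
    (fun x _ => hasDerivAt_gaussianPDFReal hv x)
    ?_ ?_ ?_
  · rw [integral_gaussianReal_eq_integral_smul hv, integral_gaussianReal_eq_integral_smul hv]
    simp only [smul_eq_mul]
    have h1 : ∫ x, gaussianPDFReal 0 v x * (x * f x) =
        -v * ∫ x, f x * (-(x / v) * gaussianPDFReal 0 v x) := by
      rw [← integral_const_mul]
      congr 1 with x
      field_simp
    rw [h1, key]
    simp only [mul_comm (f' _)]
    ring
  · have : Integrable (fun x => f x * (x * gaussianPDFReal 0 v x)) :=
      hxp.bdd_mul hfm.aestronglyMeasurable (.of_forall hfK)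
    refine (this.const_mul (-(v : ℝ)⁻¹)).congr (.of_forall fun x => ?_)
    simp only [Pi.mul_apply]
    ring
  · exact hp.bdd_mul hf'm.aestronglyMeasurable (.of_forall hfK')
  · exact hp.bdd_mul hfm.aestronglyMeasurable (.of_forall hfK)

/-- Gaussian integration by parts: if `(g, Y)` is a centered Gaussian vector, then `E g F(Y)` is the
expectation of the derivative of `F` in the direction `(E g Yⱼ)ⱼ`. -/
theorem ProbabilityTheory.HasGaussianLaw.integral_mul_eq {Ω ι : Type*} [MeasurableSpace Ω] [Fintype ι] {P : Measure Ω}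
    {g : Ω → ℝ} {Y : ι → Ω → ℝ} (hgY : HasGaussianLaw (fun ω => (g ω, fun j => Y j ω)) P)
    (hg : ∫ ω, g ω ∂P = 0) {F D : (ι → ℝ) → ℝ}
    (hFc : Measurable F) (hDc : Measurable D)
    (hFD : ∀ y x, HasDerivAt (fun x : ℝ => F (y + x • fun j => ∫ ω, g ω * Y j ω ∂P))
      (D (y + x • fun j => ∫ ω, g ω * Y j ω ∂P)) x)
    {K : ℝ} (hF : ∀ y, |F y| ≤ K) (hD : ∀ y, |D y| ≤ K) :
    ∫ ω, g ω * F (fun j => Y j ω) ∂P = ∫ ω, D (fun j => Y j ω) ∂P := by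
  have hP : IsProbabilityMeasure P := hgY.isProbabilityMeasure
  set c : ι → ℝ := fun j => ∫ ω, g ω * Y j ω ∂P with hc
  have hgl : HasGaussianLaw g P := hgY.fst
  have hYl : HasGaussianLaw (fun ω j => Y j ω) P := hgY.snd
  have hYj : ∀ j, HasGaussianLaw (Y j) P := fun j => hYl.eval j
  have hg2 : MemLp g 2 P := hgl.memLp_two
  have hmap := hgl.map_eq_gaussianReal
  rw [hg] at hmap
  set v : ℝ≥0 := Var[g; P].toNNReal with hv
  have hvar : Var[g; P] = ∫ ω, g ω ^ 2 ∂P := variance_of_integral_eq_zero hgl.aemeasurable hg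
  -- In the degenerate case `g = 0` almost surely, so the direction `c` is zero and `D`, the
  -- derivative of a constant, vanishes identically.
  by_cases hv0 : v = 0
  · have hg0 : g =ᵐ[P] 0 := by
      have h0 : ∫ ω, g ω ^ 2 ∂P = 0 := by
        rw [← hvar]
        exact le_antisymm (Real.toNNReal_eq_zero.1 hv0) (variance_nonneg _ _)
      have := (integral_eq_zero_iff_of_nonneg (fun ω => sq_nonneg (g ω)) hg2.integrable_sq).1 h0
      filter_upwards [this] with ω hω
      simpa using hω
    have hc0 : c = 0 := by
      funext j
      exact integral_eq_zero_of_ae (by filter_upwards [hg0] with ω hω; simp [hω])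
    have hD0 : ∀ y, D y = 0 := fun y => by
      have h1 := hFD y 0
      rw [hc0] at h1
      simp only [smul_zero, add_zero] at h1
      exact h1.unique (hasDerivAt_const _ _)
    simp only [hD0, integral_zero]
    exact integral_eq_zero_of_ae (by filter_upwards [hg0] with ω hω; simp [hω])
  have hvpos : 0 < v := pos_iff_ne_zero.2 hv0
  have hvar' : (v : ℝ) = ∫ ω, g ω ^ 2 ∂P := by
    rw [← hvar, hv, Real.coe_toNNReal _ (variance_nonneg _ _)]
  have hv' : (v : ℝ) ≠ 0 := by exact_mod_cast hv0
  -- The residual of the regression of `Y` on `g` is uncorrelated with `g`, hence independent of it.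
  -- For fixed `Z` only the one-dimensional formula along the direction `c` is left.
  set Z : ι → Ω → ℝ := fun j ω => Y j ω - c j / v * g ω with hZ
  have hgZ : HasGaussianLaw (fun ω => (fun _ : Unit => g ω, fun j => Z j ω)) P := by
    let L : ℝ × (ι → ℝ) →L[ℝ] (Unit → ℝ) × (ι → ℝ) :=
      (ContinuousLinearMap.pi fun _ => ContinuousLinearMap.fst ℝ ℝ (ι → ℝ)).prod
        (ContinuousLinearMap.snd ℝ ℝ (ι → ℝ) - ContinuousLinearMap.pi fun j =>
          (c j / v) • ContinuousLinearMap.fst ℝ ℝ (ι → ℝ))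
    have := hgY.map_fun L
    convert! this using 1
  have hind0 := hgZ.indepFun_of_covariance_eval (X := fun (_ : Unit) ω => g ω) (Y := Z) (fun _ j => by
    change cov[g, fun ω => Y j ω - c j / v * g ω; P] = 0
    rw [covariance_fun_sub_right hg2 (hYj j).memLp_two (hg2.const_mul _),
      covariance_const_mul_right, covariance_self hgl.aemeasurable, hvar, ← hvar',
      covariance_eq_sub hg2 (hYj j).memLp_two, hg]
    simp only [hc, Pi.mul_apply]
    field_simp
    ring)
  have hind : IndepFun g (fun ω j => Z j ω) P :=
    hind0.comp (φ := fun f : Unit → ℝ => f ()) (ψ := id) (measurable_pi_apply ()) measurable_id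
  have hZm : AEMeasurable (fun ω j => Z j ω) P := hgZ.snd.aemeasurable
  have hprod := (indepFun_iff_map_prod_eq_prod_map_map hgl.aemeasurable hZm).1 hind
  have hYZ : ∀ ω, (fun j => Y j ω) = (fun j => Z j ω) + (g ω / v) • c := fun ω => by
    funext j
    simp only [hZ, Pi.add_apply, Pi.smul_apply, smul_eq_mul]
    ring
  have hpm : AEMeasurable (fun ω => (g ω, fun j => Z j ω)) P := hgl.aemeasurable.prodMk hZm
  have : IsProbabilityMeasure (P.map g) := Measure.isProbabilityMeasure_map hgl.aemeasurable
  have : IsProbabilityMeasure (P.map fun ω j => Z j ω) := Measure.isProbabilityMeasure_map hZm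
  have hGm : Measurable fun p : ℝ × (ι → ℝ) => p.1 * F (p.2 + (p.1 / v) • c) := by fun_prop
  have hHm : Measurable fun p : ℝ × (ι → ℝ) => D (p.2 + (p.1 / v) • c) := by fun_prop
  have hK : 0 ≤ K := (abs_nonneg _).trans (hF 0)
  calc ∫ ω, g ω * F (fun j => Y j ω) ∂P
      = ∫ p, p.1 * F (p.2 + (p.1 / v) • c) ∂((P.map g).prod (P.map fun ω j => Z j ω)) := by
        rw [← hprod, integral_map hpm hGm.aestronglyMeasurable]
        simp only [hYZ]
    _ = ∫ z, ∫ x, x * F (z + (x / v) • c) ∂(P.map g) ∂(P.map fun ω j => Z j ω) := by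
        rw [integral_prod_symm]
        rw [← hprod, integrable_map_measure hGm.aestronglyMeasurable hpm]
        refine (hgl.integrable.bdd_mul (c := K)
          (f := fun ω => F ((fun j => Z j ω) + (g ω / v) • c)) ?_ (.of_forall fun ω => hF _)).congr
          (.of_forall fun ω => mul_comm _ _)
        exact ((by fun_prop : Measurable fun p : ℝ × (ι → ℝ) =>
          F (p.2 + (p.1 / v) • c)).comp_aemeasurable hpm).aestronglyMeasurable
    _ = ∫ z, ∫ x, D (z + (x / v) • c) ∂(P.map g) ∂(P.map fun ω j => Z j ω) := by
        congr 1 with z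
        -- The chain rule for `x / v` gives the factor `v⁻¹`, which cancels the variance.
        rw [hmap, integral_id_mul_gaussianReal hv0 (f' := fun x => D (z + (x / v) • c) * (v : ℝ)⁻¹)
          (K := max K (K * (v : ℝ)⁻¹)) ?_ (by fun_prop) ?_ ?_]
        · rw [integral_mul_const]; field_simp
        · intro x
          have h1 := (hFD z (x / v)).scomp x ((hasDerivAt_id x).div_const (v : ℝ))
          convert! h1 using 1
          simp [mul_comm]
        · exact fun x => (hF _).trans (le_max_left _ _)
        · intro x
          rw [abs_mul, abs_of_nonneg (by positivity : 0 ≤ (v : ℝ)⁻¹)]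
          exact (mul_le_mul_of_nonneg_right (hD _) (by positivity)).trans (le_max_right _ _)
    _ = ∫ p, D (p.2 + (p.1 / v) • c) ∂((P.map g).prod (P.map fun ω j => Z j ω)) := by
        rw [integral_prod_symm]
        exact Integrable.of_bound hHm.aestronglyMeasurable K (.of_forall fun p => hD _)
    _ = ∫ ω, D (fun j => Y j ω) ∂P := by
        rw [← hprod, integral_map hpm hHm.aestronglyMeasurable]
        simp only [hYZ]

/-! ### Interpolation between two Gaussian processes -/

/-- Two uncorrelated, jointly Gaussian, centered processes whose variances are at most `V` and
whose covariances differ by the function `D`, which is constant on the diagonal. -/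
structure GaussianPair {Ω X : Type*} [MeasurableSpace Ω] (P : Measure Ω) (g₁ g₂ : X → Ω → ℝ)
    (D : X → X → ℝ) (d K V : ℝ) : Prop where
  measurable₁ : ∀ x, Measurable (g₁ x)
  measurable₂ : ∀ x, Measurable (g₂ x)
  gaussian : IsGaussianProcess (Sum.elim g₁ g₂) P
  mean₁ : ∀ x, ∫ ω, g₁ x ω ∂P = 0
  mean₂ : ∀ x, ∫ ω, g₂ x ω ∂P = 0
  cross : ∀ x y, ∫ ω, g₁ x ω * g₂ y ω ∂P = 0
  cov_sub : ∀ x y, ∫ ω, g₁ x ω * g₁ y ω ∂P - ∫ ω, g₂ x ω * g₂ y ω ∂P = D x y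
  diag : ∀ x, D x x = d
  bound : ∀ x y, |D x y| ≤ K
  var₁ : ∀ x, ∫ ω, g₁ x ω ^ 2 ∂P ≤ V
  var₂ : ∀ x, ∫ ω, g₂ x ω ^ 2 ∂P ≤ V

/-- The interpolation `√t a + √(1 - t) b`. -/
def mix (t a b : ℝ) : ℝ := √t * a + √(1 - t) * b

lemma abs_mix_le {t : ℝ} (ht : t ∈ Icc (0 : ℝ) 1) (a b : ℝ) : |mix t a b| ≤ |a| + |b| := by
  have h1 : √t ≤ 1 := Real.sqrt_le_one.2 ht.2
  have h2 : √(1 - t) ≤ 1 := Real.sqrt_le_one.2 (by linarith [ht.1])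
  calc |mix t a b| ≤ |√t * a| + |√(1 - t) * b| := abs_add_le _ _
    _ = √t * |a| + √(1 - t) * |b| := by
      rw [abs_mul, abs_mul, abs_of_nonneg (Real.sqrt_nonneg _), abs_of_nonneg (Real.sqrt_nonneg _)]
    _ ≤ 1 * |a| + 1 * |b| := by gcongr
    _ = |a| + |b| := by ring

lemma continuous_mix (a b : ℝ) : Continuous fun t => mix t a b := by unfold mix; fun_prop

lemma hasDerivAt_mix {t : ℝ} (ht : t ∈ Ioo (0 : ℝ) 1) (a b : ℝ) :
    HasDerivAt (fun t => mix t a b) ((2 * √t)⁻¹ * a - (2 * √(1 - t))⁻¹ * b) t := by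
  have h1 := (Real.hasDerivAt_sqrt ht.1.ne').mul_const a
  have h2 := (((hasDerivAt_id t).const_sub 1).sqrt (by simpa using (sub_pos.2 ht.2).ne')).mul_const b
  convert! h1.add h2 using 1
  simp only [id]
  ring

/-- The Gibbs weights on a finite set. -/
def softmax {ι : Type*} [Fintype ι] (w h : ι → ℝ) (x : ι) : ℝ :=
  w x * Real.exp (h x) / ∑ y, w y * Real.exp (h y)

/-! ### Finite Gibbs weights: bounds and derivatives -/

section Softmax

variable {ι : Type*} [Fintype ι] [Nonempty ι] {w : ι → ℝ}

lemma sum_exp_pos (hw : ∀ x, 0 < w x) (h : ι → ℝ) : 0 < ∑ y, w y * Real.exp (h y) :=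
  Finset.sum_pos (fun y _ => mul_pos (hw y) (Real.exp_pos _)) Finset.univ_nonempty

lemma softmax_nonneg (hw : ∀ x, 0 < w x) (h : ι → ℝ) (x : ι) : 0 ≤ softmax w h x :=
  div_nonneg (mul_pos (hw x) (Real.exp_pos _)).le (sum_exp_pos hw h).le

lemma sum_softmax (hw : ∀ x, 0 < w x) (h : ι → ℝ) : ∑ x, softmax w h x = 1 := by
  simp only [softmax]
  rw [← Finset.sum_div, div_self (sum_exp_pos hw h).ne']

lemma softmax_le_one (hw : ∀ x, 0 < w x) (h : ι → ℝ) (x : ι) : softmax w h x ≤ 1 := by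
  rw [← sum_softmax hw h]
  exact Finset.single_le_sum (fun y _ => softmax_nonneg hw h y) (Finset.mem_univ x)

omit [Nonempty ι] in
lemma measurable_softmax (x : ι) : Measurable fun h : ι → ℝ => softmax w h x := by
  unfold softmax; fun_prop

lemma abs_sum_softmax_mul_le (hw : ∀ x, 0 < w x) (h : ι → ℝ) {c : ι → ℝ} {K : ℝ}
    (hc : ∀ x, |c x| ≤ K) : |∑ x, softmax w h x * c x| ≤ K := by
  calc |∑ x, softmax w h x * c x| ≤ ∑ x, softmax w h x * K := by
        refine (Finset.abs_sum_le_sum_abs _ _).trans (Finset.sum_le_sum fun x _ => ?_)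
        rw [abs_mul, abs_of_nonneg (softmax_nonneg hw h x)]
        exact mul_le_mul_of_nonneg_left (hc x) (softmax_nonneg hw h x)
    _ = K := by rw [← Finset.sum_mul, sum_softmax hw, one_mul]

lemma hasDerivAt_log_sum_exp (hw : ∀ x, 0 < w x) {h : ℝ → ι → ℝ} {h' : ι → ℝ} {t : ℝ}
    (hh : ∀ x, HasDerivAt (fun t => h t x) (h' x) t) :
    HasDerivAt (fun t => Real.log (∑ x, w x * Real.exp (h t x)))
      (∑ x, softmax w (h t) x * h' x) t := by
  have h1 : HasDerivAt (fun t => ∑ x, w x * Real.exp (h t x))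
      (∑ x, w x * (Real.exp (h t x) * h' x)) t :=
    HasDerivAt.fun_sum fun x _ => ((hh x).exp.const_mul (w x))
  convert! h1.log (sum_exp_pos hw _).ne' using 1
  rw [Finset.sum_div]
  refine Finset.sum_congr rfl fun x _ => ?_
  rw [softmax]; ring

lemma hasDerivAt_softmax (hw : ∀ x, 0 < w x) {h : ℝ → ι → ℝ} {h' : ι → ℝ} {t : ℝ}
    (hh : ∀ x, HasDerivAt (fun t => h t x) (h' x) t) (x : ι) :
    HasDerivAt (fun t => softmax w (h t) x)
      (softmax w (h t) x * (h' x - ∑ y, softmax w (h t) y * h' y)) t := by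
  have h1 : HasDerivAt (fun t => ∑ x, w x * Real.exp (h t x))
      (∑ x, w x * (Real.exp (h t x) * h' x)) t :=
    HasDerivAt.fun_sum fun x _ => ((hh x).exp.const_mul (w x))
  have hne := (sum_exp_pos hw (h t)).ne'
  convert! ((hh x).exp.const_mul (w x)).div h1 hne using 1
  have h2 : ∑ y, softmax w (h t) y * h' y =
      (∑ x, w x * (Real.exp (h t x) * h' x)) / ∑ x, w x * Real.exp (h t x) := by
    rw [Finset.sum_div]
    refine Finset.sum_congr rfl fun x _ => ?_
    rw [softmax]; ring
  rw [h2, softmax]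
  field_simp

end Softmax

/-! ### Integration by parts against Gibbs weights -/

namespace GaussianPair

variable {Ω X : Type*} [MeasurableSpace Ω] {P : Measure Ω} {g₁ g₂ : X → Ω → ℝ}
  {D : X → X → ℝ} {d K V : ℝ}

lemma comp (hg : GaussianPair P g₁ g₂ D d K V) {Y : Type*} (f : Y → X) :
    GaussianPair P (fun y => g₁ (f y)) (fun y => g₂ (f y)) (fun x y => D (f x) (f y)) d K V where
  measurable₁ x := hg.measurable₁ _
  measurable₂ x := hg.measurable₂ _
  gaussian := by
    have := hg.gaussian.comp_right (Sum.map f f)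
    convert! this using 1
    funext x
    cases x <;> rfl
  mean₁ x := hg.mean₁ _
  mean₂ x := hg.mean₂ _
  cross x y := hg.cross _ _
  cov_sub x y := hg.cov_sub _ _
  diag x := hg.diag _
  bound x y := hg.bound _ _
  var₁ x := hg.var₁ _
  var₂ x := hg.var₂ _

lemma hasGaussianLaw₁ (hg : GaussianPair P g₁ g₂ D d K V) (x : X) : HasGaussianLaw (g₁ x) P :=
  hg.gaussian.hasGaussianLaw_eval (Sum.inl x)

lemma hasGaussianLaw₂ (hg : GaussianPair P g₁ g₂ D d K V) (x : X) : HasGaussianLaw (g₂ x) P :=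
  hg.gaussian.hasGaussianLaw_eval (Sum.inr x)

lemma measurable_mix (hg : GaussianPair P g₁ g₂ D d K V) (t : ℝ) (x : X) :
    Measurable fun ω => mix t (g₁ x ω) (g₂ x ω) := by
  have := hg.measurable₁ x
  have := hg.measurable₂ x
  unfold mix
  fun_prop

lemma isProbabilityMeasure (hg : GaussianPair P g₁ g₂ D d K V) : IsProbabilityMeasure P :=
  hg.gaussian.isProbabilityMeasure

/-- The square roots are chosen for this: each derivative factor cancels against `√t` or `√(1 - t)`
and leaves `1/2`, while the mixed terms vanish because the processes are uncorrelated. The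
singularities at the endpoints are gone. -/
lemma covariance_deriv_mix (hg : GaussianPair P g₁ g₂ D d K V) {t : ℝ} (ht : t ∈ Ioo (0 : ℝ) 1)
    (x y : X) :
    ∫ ω, ((2 * √t)⁻¹ * g₁ x ω - (2 * √(1 - t))⁻¹ * g₂ x ω) * mix t (g₁ y ω) (g₂ y ω) ∂P
      = D x y / 2 := by
  have h1 : √t ≠ 0 := (Real.sqrt_pos.2 ht.1).ne'
  have h2 : √(1 - t) ≠ 0 := (Real.sqrt_pos.2 (sub_pos.2 ht.2)).ne'
  have i11 : Integrable (fun ω => g₁ x ω * g₁ y ω) P :=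
    (hg.hasGaussianLaw₁ x).memLp_two.integrable_mul (hg.hasGaussianLaw₁ y).memLp_two
  have i12 : Integrable (fun ω => g₁ x ω * g₂ y ω) P :=
    (hg.hasGaussianLaw₁ x).memLp_two.integrable_mul (hg.hasGaussianLaw₂ y).memLp_two
  have i21 : Integrable (fun ω => g₁ y ω * g₂ x ω) P :=
    (hg.hasGaussianLaw₁ y).memLp_two.integrable_mul (hg.hasGaussianLaw₂ x).memLp_two
  have i22 : Integrable (fun ω => g₂ x ω * g₂ y ω) P :=
    (hg.hasGaussianLaw₂ x).memLp_two.integrable_mul (hg.hasGaussianLaw₂ y).memLp_two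
  have hpt : ∀ ω, ((2 * √t)⁻¹ * g₁ x ω - (2 * √(1 - t))⁻¹ * g₂ x ω) * mix t (g₁ y ω) (g₂ y ω)
      = ((1 / 2) * (g₁ x ω * g₁ y ω) - (1 / 2) * (g₂ x ω * g₂ y ω))
        + ((2 * √t)⁻¹ * √(1 - t) * (g₁ x ω * g₂ y ω)
          - (2 * √(1 - t))⁻¹ * √t * (g₁ y ω * g₂ x ω)) := fun ω => by
    rw [mix]; field_simp; ring
  simp only [hpt]
  rw [integral_add (by fun_prop) (by fun_prop), integral_sub (i11.const_mul _) (i22.const_mul _),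
    integral_sub (i12.const_mul _) (i21.const_mul _)]
  simp only [integral_const_mul, hg.cross, mul_zero, sub_zero, add_zero, ← hg.cov_sub]
  ring

section Fintype

variable {ι : Type*} [Fintype ι] [Nonempty ι] {g₁ g₂ : ι → Ω → ℝ} {D : ι → ι → ℝ} {w : ι → ℝ}

omit [Nonempty ι] in
lemma hasGaussianLaw_deriv_mix (hg : GaussianPair P g₁ g₂ D d K V) (t : ℝ) (x : ι) :
    HasGaussianLaw (fun ω => ((2 * √t)⁻¹ * g₁ x ω - (2 * √(1 - t))⁻¹ * g₂ x ω,
      fun y => mix t (g₁ y ω) (g₂ y ω))) P := by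
  let e : ι ⊕ ι → (Finset.univ : Finset (ι ⊕ ι)) := fun i => ⟨i, Finset.mem_univ i⟩
  let p : ι ⊕ ι → ((↥(Finset.univ : Finset (ι ⊕ ι))) → ℝ) →L[ℝ] ℝ := fun i =>
    ContinuousLinearMap.proj (R := ℝ) (φ := fun _ => ℝ) (e i)
  have := (hg.gaussian.hasGaussianLaw Finset.univ).map_fun
    ((((2 * √t)⁻¹ • p (Sum.inl x) - (2 * √(1 - t))⁻¹ • p (Sum.inr x))).prod
      (ContinuousLinearMap.pi fun y => √t • p (Sum.inl y) + √(1 - t) • p (Sum.inr y)))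
  convert! this using 1

/-- Integration by parts in the direction `D x · / 2`. Differentiating a Gibbs weight gives the
value at `x` minus the Gibbs average; the value at `x` is `D x x / 2 = d / 2`. -/
lemma integral_deriv_mix_mul_softmax (hg : GaussianPair P g₁ g₂ D d K V) (hw : ∀ x, 0 < w x)
    {t : ℝ} (ht : t ∈ Ioo (0 : ℝ) 1) (x : ι) :
    ∫ ω, ((2 * √t)⁻¹ * g₁ x ω - (2 * √(1 - t))⁻¹ * g₂ x ω)
        * softmax w (fun y => mix t (g₁ y ω) (g₂ y ω)) x ∂P
      = ∫ ω, softmax w (fun y => mix t (g₁ y ω) (g₂ y ω)) x *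
          (d / 2 - (1 / 2) * ∑ y, softmax w (fun y => mix t (g₁ y ω) (g₂ y ω)) y * D x y) ∂P := by
  have hmean : ∫ ω, ((2 * √t)⁻¹ * g₁ x ω - (2 * √(1 - t))⁻¹ * g₂ x ω) ∂P = 0 := by
    rw [integral_sub ((hg.hasGaussianLaw₁ x).integrable.const_mul _)
      ((hg.hasGaussianLaw₂ x).integrable.const_mul _), integral_const_mul, integral_const_mul,
      hg.mean₁, hg.mean₂]
    simp
  have hms : ∀ y, Measurable fun h : ι → ℝ => softmax w h y := measurable_softmax
  have hK : 0 ≤ K := (abs_nonneg _).trans (hg.bound x x)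
  refine (hg.hasGaussianLaw_deriv_mix t x).integral_mul_eq hmean (F := fun h => softmax w h x)
    (D := fun h => softmax w h x * (d / 2 - (1 / 2) * ∑ y, softmax w h y * D x y))
    (K := max 1 K) (hms x) (by fun_prop) ?_ ?_ ?_
  · intro y s
    simp only [hg.covariance_deriv_mix ht]
    have := hasDerivAt_softmax hw (h := fun s => y + s • fun j => D x j / 2)
      (h' := fun j => D x j / 2) (t := s) (fun j => by
        have := ((hasDerivAt_id s).mul_const (D x j / 2)).const_add (y j)
        simpa using this) x
    convert! this using 1
    rw [hg.diag, Finset.mul_sum]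
    congr 2
    exact Finset.sum_congr rfl fun j _ => by ring
  · intro h
    rw [abs_of_nonneg (softmax_nonneg hw _ _)]
    exact (softmax_le_one hw h x).trans (le_max_left _ _)
  · intro h
    have h1 := abs_sum_softmax_mul_le hw h (c := fun y => D x y) (hg.bound x)
    have h2 : |d| ≤ K := hg.diag x ▸ hg.bound x x
    rw [abs_mul, abs_of_nonneg (softmax_nonneg hw _ _)]
    refine le_trans ?_ (le_max_right 1 K)
    refine (mul_le_of_le_one_left (abs_nonneg _) (softmax_le_one hw h x)).trans ?_
    rw [abs_le] at h1 h2 ⊢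
    constructor <;> linarith [h1.1, h1.2, h2.1, h2.2]

/-- The bound for `log Z` that is uniform in `t`. -/
lemma abs_log_sum_exp_le (hw : ∀ x, 0 < w x) {h e : ι → ℝ} (he : ∀ x, |h x| ≤ e x) (x₀ : ι) :
    |Real.log (∑ x, w x * Real.exp (h x))| ≤
      ∑ x, w x * Real.exp (e x) + |Real.log (w x₀)| + e x₀ := by
  have hpos := sum_exp_pos hw h
  have he0 : 0 ≤ e x₀ := (abs_nonneg _).trans (he x₀)
  rw [abs_le]
  constructor
  · have h1 : Real.log (w x₀) + h x₀ ≤ Real.log (∑ x, w x * Real.exp (h x)) := by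
      rw [← Real.log_exp (h x₀), ← Real.log_mul (hw x₀).ne' (Real.exp_pos _).ne']
      exact Real.log_le_log (mul_pos (hw x₀) (Real.exp_pos _))
        (Finset.single_le_sum (f := fun x => w x * Real.exp (h x))
          (fun y _ => (mul_pos (hw y) (Real.exp_pos _)).le) (Finset.mem_univ x₀))
    have h2 := neg_abs_le (Real.log (w x₀))
    have h3 := (neg_le_neg (he x₀)).trans (neg_abs_le (h x₀))
    have h4 := sum_exp_pos hw e
    linarith
  · have h1 : ∑ x, w x * Real.exp (h x) ≤ ∑ x, w x * Real.exp (e x) :=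
      Finset.sum_le_sum fun x _ => mul_le_mul_of_nonneg_left
        (Real.exp_le_exp.2 ((le_abs_self _).trans (he x))) (hw x).le
    have h2 := Real.log_le_self hpos.le
    have h3 := abs_nonneg (Real.log (w x₀))
    linarith

end Fintype

end GaussianPair

/-! ### Exponential moments and the interpolation formula on finite sets -/

lemma ProbabilityTheory.HasGaussianLaw.integrable_exp_mul {Ω : Type*} [MeasurableSpace Ω]
    {P : Measure Ω} {g : Ω → ℝ} (hg : HasGaussianLaw g P) (s : ℝ) :
    Integrable (fun ω => Real.exp (s * g ω)) P := by
  have h := integrable_exp_mul_gaussianReal (μ := ∫ ω, g ω ∂P) (v := Var[g; P].toNNReal) s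
  rw [← hg.map_eq_gaussianReal, integrable_map_measure (by fun_prop) hg.aemeasurable] at h
  exact h

lemma ProbabilityTheory.HasGaussianLaw.integral_exp_mul_le {Ω : Type*} [MeasurableSpace Ω]
    {P : Measure Ω} {g : Ω → ℝ} (hg : HasGaussianLaw g P) (h0 : ∫ ω, g ω ∂P = 0) {V : ℝ}
    (hV : ∫ ω, g ω ^ 2 ∂P ≤ V) (s : ℝ) :
    ∫ ω, Real.exp (s * g ω) ∂P ≤ Real.exp (V * s ^ 2 / 2) := by
  have := hg.isProbabilityMeasure
  have h := mgf_gaussianReal hg.map_eq_gaussianReal s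
  rw [mgf] at h
  rw [h, h0, Real.coe_toNNReal _ (variance_nonneg _ _),
    variance_of_integral_eq_zero hg.aemeasurable h0]
  refine Real.exp_le_exp.2 ?_
  linarith [mul_le_mul_of_nonneg_right hV (sq_nonneg s)]

/-- By the inequality of the means for `e^|a|` and `e^|b|`. It removes the absolute values: under a
centered Gaussian of variance at most `V`, each of the four exponentials has mean at most `exp (2 *
V)`, whence the constant `2 * exp (2 * V)`. -/
lemma Real.exp_abs_add_abs_le (a b : ℝ) : Real.exp (|a| + |b|) ≤
    (1 / 2) * (Real.exp (2 * a) + Real.exp (-2 * a) + (Real.exp (2 * b) + Real.exp (-2 * b))) := by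
  have h : ∀ a : ℝ, Real.exp |a| ^ 2 ≤ Real.exp (2 * a) + Real.exp (-2 * a) := fun a => by
    rw [← Real.exp_nat_mul]
    rcases abs_cases a with ⟨h, _⟩ | ⟨h, _⟩ <;> rw [h]
    · exact le_add_of_nonneg_right (Real.exp_pos _).le
    · rw [show ((2 : ℕ) : ℝ) * -a = -2 * a by push_cast; ring]
      exact le_add_of_nonneg_left (Real.exp_pos _).le
  rw [Real.exp_add]
  nlinarith [h a, h b, sq_nonneg (Real.exp |a| - Real.exp |b|)]

namespace GaussianPair

variable {Ω X : Type*} [MeasurableSpace Ω] {P : Measure Ω} {g₁ g₂ : X → Ω → ℝ}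
  {D : X → X → ℝ} {d K V : ℝ}

lemma integrable_exp_abs (hg : GaussianPair P g₁ g₂ D d K V) (x : X) :
    Integrable (fun ω => Real.exp (|g₁ x ω| + |g₂ x ω|)) P := by
  have := hg.measurable₁ x
  have := hg.measurable₂ x
  have h1 := (hg.hasGaussianLaw₁ x).integrable_exp_mul
  have h2 := (hg.hasGaussianLaw₂ x).integrable_exp_mul
  refine ((((h1 2).add (h1 (-2))).add ((h2 2).add (h2 (-2)))).const_mul (1 / 2)).mono'
    (by fun_prop) (.of_forall fun ω => ?_)
  rw [Real.norm_eq_abs, Real.abs_exp]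
  exact Real.exp_abs_add_abs_le _ _

lemma integral_exp_abs_le (hg : GaussianPair P g₁ g₂ D d K V) (x : X) :
    ∫ ω, Real.exp (|g₁ x ω| + |g₂ x ω|) ∂P ≤ 2 * Real.exp (2 * V) := by
  have h1 := (hg.hasGaussianLaw₁ x).integrable_exp_mul
  have h2 := (hg.hasGaussianLaw₂ x).integrable_exp_mul
  have e1 := (hg.hasGaussianLaw₁ x).integral_exp_mul_le (hg.mean₁ x) (hg.var₁ x)
  have e2 := (hg.hasGaussianLaw₂ x).integral_exp_mul_le (hg.mean₂ x) (hg.var₂ x)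
  have hV : ∀ s : ℝ, s ^ 2 = 4 → V * s ^ 2 / 2 = 2 * V := fun s hs => by rw [hs]; ring
  have a1 := e1 2
  have a2 := e1 (-2)
  have a3 := e2 2
  have a4 := e2 (-2)
  rw [hV _ (by norm_num)] at a1 a2 a3 a4
  calc ∫ ω, Real.exp (|g₁ x ω| + |g₂ x ω|) ∂P
      ≤ ∫ ω, (1 / 2) * (Real.exp (2 * g₁ x ω) + Real.exp (-2 * g₁ x ω)
        + (Real.exp (2 * g₂ x ω) + Real.exp (-2 * g₂ x ω))) ∂P :=
        integral_mono (hg.integrable_exp_abs x)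
          ((((h1 2).add (h1 (-2))).add ((h2 2).add (h2 (-2)))).const_mul (1 / 2))
          fun ω => Real.exp_abs_add_abs_le _ _
    _ = (1 / 2) * (∫ ω, Real.exp (2 * g₁ x ω) ∂P + ∫ ω, Real.exp (-2 * g₁ x ω) ∂P
        + (∫ ω, Real.exp (2 * g₂ x ω) ∂P + ∫ ω, Real.exp (-2 * g₂ x ω) ∂P)) := by
        rw [integral_const_mul, integral_add (by fun_prop) (by fun_prop),
          integral_add (h1 2) (h1 (-2)), integral_add (h2 2) (h2 (-2))]
    _ ≤ 2 * Real.exp (2 * V) := by linarith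

section Fintype

variable {ι : Type*} [Fintype ι] {g₁ g₂ : ι → Ω → ℝ} {D : ι → ι → ℝ} {w : ι → ℝ}

lemma integrable_log_bound (hg : GaussianPair P g₁ g₂ D d K V) (w : ι → ℝ) (x₀ : ι) :
    Integrable (fun ω => ∑ x, w x * Real.exp (|g₁ x ω| + |g₂ x ω|) + |Real.log (w x₀)|
      + (|g₁ x₀ ω| + |g₂ x₀ ω|)) P := by
  have := hg.isProbabilityMeasure
  exact ((integrable_finsetSum _ fun x _ => (hg.integrable_exp_abs x).const_mul _).add
    (integrable_const _)).add
    ((hg.hasGaussianLaw₁ x₀).integrable.abs.add (hg.hasGaussianLaw₂ x₀).integrable.abs)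

lemma measurable_log_sum (hg : GaussianPair P g₁ g₂ D d K V) (t : ℝ) :
    Measurable fun ω => Real.log (∑ x, w x * Real.exp (mix t (g₁ x ω) (g₂ x ω))) := by
  have := hg.measurable_mix t
  fun_prop

variable [Nonempty ι]

lemma integrable_log_sum (hg : GaussianPair P g₁ g₂ D d K V) (hw : ∀ x, 0 < w x) {t : ℝ}
    (ht : t ∈ Icc (0 : ℝ) 1) :
    Integrable (fun ω => Real.log (∑ x, w x * Real.exp (mix t (g₁ x ω) (g₂ x ω)))) P :=
  (hg.integrable_log_bound w (Classical.arbitrary ι)).mono'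
    (hg.measurable_log_sum t).aestronglyMeasurable
    (.of_forall fun _ => abs_log_sum_exp_le hw (fun _ => abs_mix_le ht _ _) _)

lemma continuousOn_integral_log_sum (hg : GaussianPair P g₁ g₂ D d K V) (hw : ∀ x, 0 < w x) :
    ContinuousOn (fun t => ∫ ω, Real.log (∑ x, w x * Real.exp (mix t (g₁ x ω) (g₂ x ω))) ∂P)
      (Icc 0 1) := by
  refine continuousOn_of_dominated (fun t _ => (hg.measurable_log_sum t).aestronglyMeasurable)
    (fun t ht => .of_forall fun ω => abs_log_sum_exp_le hw (fun x => abs_mix_le ht _ _)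
      (Classical.arbitrary ι)) (hg.integrable_log_bound w _) (.of_forall fun ω => ?_)
  refine Continuous.continuousOn (Continuous.log ?_ fun t => (sum_exp_pos hw _).ne')
  exact continuous_finsetSum _ fun x _ => ((continuous_mix _ _).rexp).const_mul _

lemma integrable_softmax_mul (hg : GaussianPair P g₁ g₂ D d K V) (hw : ∀ x, 0 < w x) (t : ℝ)
    (x : ι) {f : Ω → ℝ} (hf : Integrable f P) :
    Integrable (fun ω => softmax w (fun y => mix t (g₁ y ω) (g₂ y ω)) x * f ω) P := by
  refine hf.bdd_mul (c := 1) ?_ (.of_forall fun ω => ?_)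
  · exact ((measurable_softmax x).comp
      (measurable_pi_lambda _ fun y => hg.measurable_mix t y)).aestronglyMeasurable
  · rw [Real.norm_eq_abs, abs_of_nonneg (softmax_nonneg hw _ _)]
    exact softmax_le_one hw _ _

lemma integral_deriv_log_sum (hg : GaussianPair P g₁ g₂ D d K V) (hw : ∀ x, 0 < w x)
    {t : ℝ} (ht : t ∈ Ioo (0 : ℝ) 1) :
    ∫ ω, ∑ x, softmax w (fun y => mix t (g₁ y ω) (g₂ y ω)) x *
        ((2 * √t)⁻¹ * g₁ x ω - (2 * √(1 - t))⁻¹ * g₂ x ω) ∂P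
      = d / 2 - (1 / 2) * ∫ ω, ∑ x, ∑ y, softmax w (fun y => mix t (g₁ y ω) (g₂ y ω)) x *
        softmax w (fun y => mix t (g₁ y ω) (g₂ y ω)) y * D x y ∂P := by
  have := hg.isProbabilityMeasure
  have hint : ∀ x, Integrable (fun ω => ∑ y, softmax w (fun y => mix t (g₁ y ω) (g₂ y ω)) y *
      D x y) P := fun x => integrable_finsetSum _ fun y _ =>
    hg.integrable_softmax_mul hw t y (integrable_const _)
  have hi : ∀ x, Integrable (fun ω => (2 * √t)⁻¹ * g₁ x ω - (2 * √(1 - t))⁻¹ * g₂ x ω) P :=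
    fun x => ((hg.hasGaussianLaw₁ x).integrable.const_mul _).sub
      ((hg.hasGaussianLaw₂ x).integrable.const_mul _)
  rw [integral_finsetSum _ fun x _ => hg.integrable_softmax_mul hw t x (hi x)]
  have h1 : ∀ x, ∫ ω, softmax w (fun y => mix t (g₁ y ω) (g₂ y ω)) x *
        ((2 * √t)⁻¹ * g₁ x ω - (2 * √(1 - t))⁻¹ * g₂ x ω) ∂P = _ := fun x =>
    (integral_congr_ae (.of_forall fun ω => mul_comm _ _)).trans
      (hg.integral_deriv_mix_mul_softmax hw ht x)
  simp only [h1]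
  have hi' : ∀ x, Integrable (fun ω => d / 2 - (1 / 2) * ∑ y,
      softmax w (fun y => mix t (g₁ y ω) (g₂ y ω)) y * D x y) P :=
    fun x => (integrable_const _).sub ((hint x).const_mul _)
  rw [← integral_finsetSum _ fun x _ => hg.integrable_softmax_mul hw t x (hi' x)]
  have h2 : ∀ ω, ∑ x, softmax w (fun y => mix t (g₁ y ω) (g₂ y ω)) x *
      (d / 2 - (1 / 2) * ∑ y, softmax w (fun y => mix t (g₁ y ω) (g₂ y ω)) y * D x y)
      = d / 2 - (1 / 2) * ∑ x, ∑ y, softmax w (fun y => mix t (g₁ y ω) (g₂ y ω)) x *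
        softmax w (fun y => mix t (g₁ y ω) (g₂ y ω)) y * D x y := fun ω => by
    simp only [mul_sub, Finset.sum_sub_distrib]
    rw [← Finset.sum_mul, sum_softmax hw, one_mul, Finset.mul_sum]
    congr 1
    refine Finset.sum_congr rfl fun x _ => ?_
    rw [Finset.mul_sum, Finset.mul_sum, Finset.mul_sum]
    exact Finset.sum_congr rfl fun y _ => by ring
  simp only [h2]
  rw [integral_sub (integrable_const _), integral_const_mul]
  · simp
  · refine Integrable.const_mul (integrable_finsetSum _ fun x _ => ?_) _
    simp only [mul_assoc, ← Finset.mul_sum]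
    exact hg.integrable_softmax_mul hw t x (hint x)

lemma hasDerivAt_integral_log_sum (hg : GaussianPair P g₁ g₂ D d K V) (hw : ∀ x, 0 < w x)
    {t : ℝ} (ht : t ∈ Ioo (0 : ℝ) 1) :
    HasDerivAt (fun t => ∫ ω, Real.log (∑ x, w x * Real.exp (mix t (g₁ x ω) (g₂ x ω))) ∂P)
      (d / 2 - (1 / 2) * ∫ ω, ∑ x, ∑ y, softmax w (fun y => mix t (g₁ y ω) (g₂ y ω)) x *
        softmax w (fun y => mix t (g₁ y ω) (g₂ y ω)) y * D x y ∂P) t := by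
  rw [← hg.integral_deriv_log_sum hw ht]
  -- Dominating the derivative needs a neighbourhood that stays away from 0 and 1, where its
  -- coefficients are unbounded.
  obtain ⟨a, ha0, hat⟩ := exists_between ht.1
  obtain ⟨b, htb, hb1⟩ := exists_between ht.2
  have hm1 := hg.measurable₁
  have hm2 := hg.measurable₂
  set c : ℝ := (2 * √a)⁻¹ + (2 * √(1 - b))⁻¹ with hc
  have hsa : 0 < √a := Real.sqrt_pos.2 ha0
  have hsb : 0 < √(1 - b) := Real.sqrt_pos.2 (sub_pos.2 hb1)
  refine (hasDerivAt_integral_of_dominated_loc_of_deriv_le (𝕜 := ℝ) (s := Ioo a b)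
    (bound := fun ω => ∑ x, c * (|g₁ x ω| + |g₂ x ω|))
    (F' := fun t ω => ∑ x, softmax w (fun y => mix t (g₁ y ω) (g₂ y ω)) x *
        ((2 * √t)⁻¹ * g₁ x ω - (2 * √(1 - t))⁻¹ * g₂ x ω))
    (Ioo_mem_nhds hat htb) (.of_forall fun t => (hg.measurable_log_sum t).aestronglyMeasurable)
    (hg.integrable_log_sum hw (Ioo_subset_Icc_self ht)) ?_ (.of_forall fun ω s hs => ?_) ?_
    (.of_forall fun ω s hs => ?_)).2
  · refine (Finset.measurable_fun_sum _ fun x _ => ?_).aestronglyMeasurable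
    have := (measurable_softmax (w := w) x).comp
      (measurable_pi_lambda _ fun y => hg.measurable_mix t y)
    exact this.mul (by fun_prop)
  · refine (Finset.abs_sum_le_sum_abs _ _).trans (Finset.sum_le_sum fun x _ => ?_)
    rw [abs_mul, abs_of_nonneg (softmax_nonneg hw _ _)]
    refine (mul_le_of_le_one_left (abs_nonneg _) (softmax_le_one hw _ _)).trans ?_
    have h1 : (2 * √s)⁻¹ ≤ c := by
      have : (2 * √s)⁻¹ ≤ (2 * √a)⁻¹ := by
        gcongr
        exact hs.1.le
      exact this.trans (le_add_of_nonneg_right (by positivity))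
    have h2 : (2 * √(1 - s))⁻¹ ≤ c := by
      have : (2 * √(1 - s))⁻¹ ≤ (2 * √(1 - b))⁻¹ := by
        gcongr
        exact hs.2.le
      exact this.trans (le_add_of_nonneg_left (by positivity))
    calc |(2 * √s)⁻¹ * g₁ x ω - (2 * √(1 - s))⁻¹ * g₂ x ω|
        ≤ |(2 * √s)⁻¹ * g₁ x ω| + |(2 * √(1 - s))⁻¹ * g₂ x ω| := abs_sub _ _
      _ = (2 * √s)⁻¹ * |g₁ x ω| + (2 * √(1 - s))⁻¹ * |g₂ x ω| := by
        rw [abs_mul, abs_mul, abs_of_nonneg (a := (2 * √s)⁻¹) (by positivity),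
          abs_of_nonneg (a := (2 * √(1 - s))⁻¹) (by positivity)]
      _ ≤ c * |g₁ x ω| + c * |g₂ x ω| := by gcongr
      _ = c * (|g₁ x ω| + |g₂ x ω|) := by ring
  · exact integrable_finsetSum _ fun x _ => ((hg.hasGaussianLaw₁ x).integrable.abs.add
      (hg.hasGaussianLaw₂ x).integrable.abs).const_mul _
  · exact hasDerivAt_log_sum_exp hw (h := fun t x => mix t (g₁ x ω) (g₂ x ω)) fun x =>
      hasDerivAt_mix ⟨ha0.trans hs.1, hs.2.trans hb1⟩ _ _

/-- After integration by parts the integrand is bounded by `K` and has no singularity in `t`.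
Continuity holds on all of `ℝ` because `Real.sqrt` is continuous there, being zero on negative
numbers. -/
lemma continuous_integral_softmax (hg : GaussianPair P g₁ g₂ D d K V) (hw : ∀ x, 0 < w x) :
    Continuous fun t => ∫ ω, ∑ x, ∑ y, softmax w (fun y => mix t (g₁ y ω) (g₂ y ω)) x *
        softmax w (fun y => mix t (g₁ y ω) (g₂ y ω)) y * D x y ∂P := by
  have := hg.isProbabilityMeasure
  have hsm : ∀ t x, Measurable fun ω => softmax w (fun y => mix t (g₁ y ω) (g₂ y ω)) x :=
    fun t x => (measurable_softmax (w := w) x).comp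
      (measurable_pi_lambda _ fun y => hg.measurable_mix t y)
  refine continuous_of_dominated (bound := fun _ => K) (fun t => ?_)
    (fun t => .of_forall fun ω => ?_) (integrable_const K) (.of_forall fun ω => ?_)
  · have := hsm t
    exact (by fun_prop : Measurable _).aestronglyMeasurable
  · simp only [mul_assoc, ← Finset.mul_sum]
    exact abs_sum_softmax_mul_le hw _ fun x => abs_sum_softmax_mul_le hw _ (hg.bound x)
  · have hc : ∀ x, Continuous fun t => softmax w (fun y => mix t (g₁ y ω) (g₂ y ω)) x := fun x =>
      Continuous.div (((continuous_mix _ _).rexp).const_mul _)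
        (continuous_finsetSum _ fun x _ => ((continuous_mix _ _).rexp).const_mul _)
        fun t => (sum_exp_pos hw _).ne'
    fun_prop

/-- The integrated form of the Gaussian interpolation formula on a finite set. -/
lemma integral_log_sum_sub (hg : GaussianPair P g₁ g₂ D d K V) (hw : ∀ x, 0 < w x) {a b : ℝ}
    (ha : 0 ≤ a) (hab : a ≤ b) (hb : b ≤ 1) :
    ∫ t in a..b, (d / 2 - (1 / 2) * ∫ ω, ∑ x, ∑ y,
        softmax w (fun y => mix t (g₁ y ω) (g₂ y ω)) x *
        softmax w (fun y => mix t (g₁ y ω) (g₂ y ω)) y * D x y ∂P) =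
      ∫ ω, Real.log (∑ x, w x * Real.exp (mix b (g₁ x ω) (g₂ x ω))) ∂P -
      ∫ ω, Real.log (∑ x, w x * Real.exp (mix a (g₁ x ω) (g₂ x ω))) ∂P := by
  -- At the endpoints only continuity of the free energy is used; differentiability is needed in the
  -- interior alone.
  refine intervalIntegral.integral_eq_sub_of_hasDerivAt_of_le hab
    (f := fun t => ∫ ω, Real.log (∑ x, w x * Real.exp (mix t (g₁ x ω) (g₂ x ω))) ∂P)
    ((hg.continuousOn_integral_log_sum hw).mono (Icc_subset_Icc ha hb))
    (fun t ht => hg.hasDerivAt_integral_log_sum hw ⟨ha.trans_lt ht.1, ht.2.trans_le hb⟩) ?_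
  exact (continuous_const.sub ((hg.continuous_integral_softmax hw).const_mul _)).intervalIntegrable
    _ _

end Fintype

end GaussianPair

/-! ### Averages over two independent samples from normalized weights -/

/-- The average of `f` over two independent points, sampled with probabilities proportional
to `b`. -/
def pairAverage {X : Type*} (b : X → ℝ) (f : X → X → ℝ) : ℝ :=
  ∑' p : X × X, b p.1 / (∑' x, b x) * (b p.2 / ∑' x, b x) * f p.1 p.2

section PairAverage

variable {X : Type*} {b : X → ℝ} {f g : X → X → ℝ} {K : ℝ}

lemma pairAverage_eq (b : X → ℝ) (f : X → X → ℝ) :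
    pairAverage b f = (∑' p : X × X, b p.1 * b p.2 * f p.1 p.2) / (∑' x, b x) ^ 2 := by
  rw [pairAverage, ← tsum_div_const]
  exact tsum_congr fun p => by ring

lemma summable_mul_prod (hb0 : ∀ x, 0 ≤ b x) (hb : Summable b) :
    Summable fun p : X × X => b p.1 * b p.2 :=
  hb.mul_of_nonneg hb hb0 hb0

lemma abs_mul_mul_le (hb0 : ∀ x, 0 ≤ b x) (hf : ∀ x y, |f x y| ≤ K) (p : X × X) :
    |b p.1 * b p.2 * f p.1 p.2| ≤ b p.1 * b p.2 * K := by
  rw [abs_mul, abs_of_nonneg (mul_nonneg (hb0 _) (hb0 _))]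
  exact mul_le_mul_of_nonneg_left (hf _ _) (mul_nonneg (hb0 _) (hb0 _))

lemma summable_mul_mul (hb0 : ∀ x, 0 ≤ b x) (hb : Summable b) (hf : ∀ x y, |f x y| ≤ K) :
    Summable fun p : X × X => b p.1 * b p.2 * f p.1 p.2 :=
  Summable.of_norm_bounded ((summable_mul_prod hb0 hb).mul_right K) (abs_mul_mul_le hb0 hf)

lemma abs_pairAverage_le (hb0 : ∀ x, 0 ≤ b x) (hb : Summable b) (hpos : 0 < ∑' x, b x)
    (hf : ∀ x y, |f x y| ≤ K) : |pairAverage b f| ≤ K := by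
  rw [pairAverage_eq, abs_div, abs_of_pos (pow_pos hpos 2), div_le_iff₀ (pow_pos hpos 2)]
  calc |∑' p : X × X, b p.1 * b p.2 * f p.1 p.2| ≤ ∑' p : X × X, b p.1 * b p.2 * K :=
        tsum_of_norm_bounded (f := fun p : X × X => b p.1 * b p.2 * f p.1 p.2)
          ((summable_mul_prod hb0 hb).mul_right K).hasSum (abs_mul_mul_le hb0 hf)
    _ = K * (∑' x, b x) ^ 2 := by
        rw [tsum_mul_right, sq, hb.tsum_mul_tsum hb (summable_mul_prod hb0 hb), mul_comm]

lemma pairAverage_const_mul_sub (hb0 : ∀ x, 0 ≤ b x) (hb : Summable b)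
    (hf : ∀ x y, |f x y| ≤ K) {K' : ℝ} (hg : ∀ x y, |g x y| ≤ K') (c : ℝ) :
    pairAverage b (fun x y => c * (f x y - g x y)) = c * (pairAverage b f - pairAverage b g) := by
  simp only [pairAverage_eq]
  rw [← sub_div, ← (summable_mul_mul hb0 hb hf).tsum_sub (summable_mul_mul hb0 hb hg),
    ← mul_div_assoc, ← tsum_mul_left]
  congr 1
  exact tsum_congr fun p => by ring

/-- Squares are cofinal among finite sets of pairs, so double sums may be computed along `s ×ˢ s`,
the form in which the finite formula delivers them. -/
lemma tendsto_finset_product_self :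
    Filter.Tendsto (fun s : Finset X => s ×ˢ s) Filter.atTop Filter.atTop := by
  classical
  refine Filter.tendsto_atTop_atTop_of_monotone
    (fun s t h => Finset.product_subset_product h h) fun t => ?_
  refine ⟨t.image Prod.fst ∪ t.image Prod.snd, fun p hp => ?_⟩
  rw [Finset.mem_product]
  exact ⟨Finset.mem_union_left _ (Finset.mem_image_of_mem _ hp),
    Finset.mem_union_right _ (Finset.mem_image_of_mem _ hp)⟩

lemma tendsto_pairAverage (hb0 : ∀ x, 0 ≤ b x) (hb : Summable b) (hpos : 0 < ∑' x, b x)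
    (hf : ∀ x y, |f x y| ≤ K) :
    Filter.Tendsto (fun s : Finset X => (∑ p ∈ s ×ˢ s, b p.1 * b p.2 * f p.1 p.2) /
      (∑ x ∈ s, b x) ^ 2) Filter.atTop (𝓝 (pairAverage b f)) := by
  rw [pairAverage_eq]
  exact ((summable_mul_mul hb0 hb hf).hasSum.comp tendsto_finset_product_self).div
    (hb.hasSum.pow 2) (pow_pos hpos 2).ne'

lemma continuousOn_pairAverage {T : Set ℝ} {b : ℝ → X → ℝ} {M : X → ℝ}
    (hb0 : ∀ t ∈ T, ∀ x, 0 ≤ b t x) (hc : ∀ x, ContinuousOn (fun t => b t x) T)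
    (hM : Summable M) (hbM : ∀ t ∈ T, ∀ x, b t x ≤ M x) (hpos : ∀ t ∈ T, 0 < ∑' x, b t x)
    (hf : ∀ x y, |f x y| ≤ K) : ContinuousOn (fun t => pairAverage (b t) f) T := by
  rcases T.eq_empty_or_nonempty with rfl | ⟨t₀, ht₀⟩
  · exact continuousOn_empty _
  have hM0 : ∀ x, 0 ≤ M x := fun x => (hb0 t₀ ht₀ x).trans (hbM t₀ ht₀ x)
  simp only [pairAverage_eq]
  refine ContinuousOn.div ?_ ((continuousOn_tsum hc hM fun x t ht => ?_).pow 2)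
    fun t ht => (pow_pos (hpos t ht) 2).ne'
  · refine continuousOn_tsum (fun p => ((hc _).mul (hc _)).mul continuousOn_const)
      ((summable_mul_prod hM0 hM).mul_right K) fun p t ht => ?_
    refine (abs_mul_mul_le (hb0 t ht) hf p).trans ?_
    have hK : 0 ≤ K := (abs_nonneg _).trans (hf p.1 p.2)
    exact mul_le_mul_of_nonneg_right
      (mul_le_mul (hbM t ht _) (hbM t ht _) (hb0 t ht _) (hM0 _)) hK
  · rw [Real.norm_eq_abs, abs_of_nonneg (hb0 t ht x)]
    exact hbM t ht x

lemma measurable_pairAverage {Ω : Type*} [MeasurableSpace Ω] [Countable X] {b : X → Ω → ℝ}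
    (hb : ∀ x, Measurable (b x)) : Measurable fun ω => pairAverage (fun x => b x ω) f := by
  have h : Measurable fun ω => ∑' x, b x ω := Measurable.tsum hb
  unfold pairAverage
  exact Measurable.tsum fun p =>
    (((hb p.1).div h).mul ((hb p.2).div h)).mul_const _

lemma sum_softmax_mul_subtype (w h : X → ℝ) (s : Finset X) (f : X → X → ℝ) :
    ∑ x : s, ∑ y : s, softmax (fun x : s => w x) (fun x : s => h x) x *
      softmax (fun x : s => w x) (fun x : s => h x) y * f x y =
    (∑ p ∈ s ×ˢ s, w p.1 * Real.exp (h p.1) * (w p.2 * Real.exp (h p.2)) * f p.1 p.2) /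
      (∑ x ∈ s, w x * Real.exp (h x)) ^ 2 := by
  have hsum : ∑ y : s, w y * Real.exp (h y) = ∑ y ∈ s, w y * Real.exp (h y) :=
    Finset.sum_coe_sort s fun y => w y * Real.exp (h y)
  rw [Finset.sum_product, Finset.sum_div, ← Finset.sum_coe_sort s]
  refine Finset.sum_congr rfl fun x _ => ?_
  rw [Finset.sum_div, ← Finset.sum_coe_sort s]
  refine Finset.sum_congr rfl fun y _ => ?_
  simp only [softmax, hsum]
  ring

end PairAverage

/-- If the weights have total mass at least one, then `log ∑ w e^h` is bounded by
`∑ w e^|h|`. -/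
lemma abs_log_tsum_exp_le {X : Type*} {w h e : X → ℝ} (hw : ∀ x, 0 ≤ w x)
    (hws : Summable w) (hw1 : 1 ≤ ∑' x, w x) (he : ∀ x, |h x| ≤ e x)
    (hs : Summable fun x => w x * Real.exp (e x)) :
    |Real.log (∑' x, w x * Real.exp (h x))| ≤ ∑' x, w x * Real.exp (e x) := by
  have hle : ∀ x, w x * Real.exp (h x) ≤ w x * Real.exp (e x) := fun x =>
    mul_le_mul_of_nonneg_left (Real.exp_le_exp.2 ((le_abs_self _).trans (he x))) (hw x)
  have hbs : Summable fun x => w x * Real.exp (h x) :=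
    Summable.of_nonneg_of_le (fun x => mul_nonneg (hw x) (Real.exp_pos _).le) hle hs
  have hwe : ∀ x, |w x * h x| ≤ w x * Real.exp (e x) := fun x => by
    rw [abs_mul, abs_of_nonneg (hw x)]
    refine mul_le_mul_of_nonneg_left ?_ (hw x)
    linarith [he x, Real.add_one_le_exp (e x)]
  have hhs : Summable fun x => w x * h x := Summable.of_norm_bounded hs hwe
  have hpos : 0 < ∑' x, w x * Real.exp (h x) := by
    obtain ⟨x, hx⟩ : ∃ x, 0 < w x := by
      by_contra! hcon
      have : ∑' x, w x = 0 := by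
        rw [← tsum_zero (β := X)]
        exact tsum_congr fun x => le_antisymm (hcon x) (hw x)
      linarith
    exact hbs.tsum_pos (fun x => mul_nonneg (hw x) (Real.exp_pos _).le) x
      (mul_pos hx (Real.exp_pos _))
  have hM0 : 0 ≤ ∑' x, w x * Real.exp (e x) :=
    tsum_nonneg fun x => mul_nonneg (hw x) (Real.exp_pos _).le
  rw [abs_le]
  constructor
  · set W := ∑' x, w x with hW
    set Z := ∑' x, w x * Real.exp (h x) with hZ
    -- Jensen's inequality through the tangent line of the exponential at `c`: summing `w (1 + h -
    -- c) ≤ w e^(h - c)` gives `∑ w h ≤ c W`.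
    set c := Real.log (Z / W) with hc
    have hW0 : 0 < W := by linarith
    have hexp : ∑' x, w x * Real.exp (h x) * Real.exp (-c) = W := by
      rw [tsum_mul_right, ← hZ, Real.exp_neg, hc, Real.exp_log (div_pos hpos hW0)]
      field_simp
    have htan : ∑' x, (w x + w x * h x - c * w x) ≤ W := by
      rw [← hexp]
      refine Summable.tsum_le_tsum (fun x => ?_) ((hws.add hhs).sub (hws.mul_left c))
        (hbs.mul_right _)
      rw [mul_assoc, ← Real.exp_add]
      have := mul_le_mul_of_nonneg_left (Real.add_one_le_exp (h x + -c)) (hw x)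
      linarith
    rw [(hws.add hhs).tsum_sub (hws.mul_left c), hws.tsum_add hhs, tsum_mul_left, ← hW] at htan
    have hsumabs : -(∑' x, w x * Real.exp (e x)) ≤ ∑' x, w x * h x :=
      (abs_le.1 (tsum_of_norm_bounded (f := fun x => w x * h x) hs.hasSum hwe)).1
    have hcW : -(∑' x, w x * Real.exp (e x)) ≤ c * W := by linarith
    have hlogc : Real.log Z = c + Real.log W := by
      rw [hc, Real.log_div hpos.ne' hW0.ne']; ring
    have hlogW : 0 ≤ Real.log W := Real.log_nonneg hw1
    -- Here `W ≥ 1` enters: it gives `log Z ≥ c`, and for negative `c` also `c W ≤ c`.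
    rcases le_or_gt 0 c with h0 | h0
    · linarith
    · have : c * W ≤ c := by nlinarith
      linarith
  · exact (Real.log_le_self hpos.le).trans (hbs.tsum_le_tsum hle hs)

/-! ### Gaussian interpolation for fixed summable weights on a countable set -/

namespace GaussianPair

section Mix

variable {Ω X : Type*} {g₁ g₂ : X → Ω → ℝ} {w : X → ℝ}

lemma exp_mix_le (hw : ∀ x, 0 < w x) {t : ℝ} (ht : t ∈ Icc (0 : ℝ) 1) (ω : Ω) (x : X) :
    w x * Real.exp (mix t (g₁ x ω) (g₂ x ω)) ≤ w x * Real.exp (|g₁ x ω| + |g₂ x ω|) :=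
  mul_le_mul_of_nonneg_left
    (Real.exp_le_exp.2 ((le_abs_self _).trans (abs_mix_le ht _ _))) (hw x).le

lemma summable_exp_mix (hw : ∀ x, 0 < w x) {t : ℝ} (ht : t ∈ Icc (0 : ℝ) 1) {ω : Ω}
    (hs : Summable fun x => w x * Real.exp (|g₁ x ω| + |g₂ x ω|)) :
    Summable fun x => w x * Real.exp (mix t (g₁ x ω) (g₂ x ω)) :=
  Summable.of_nonneg_of_le (fun x => (mul_pos (hw x) (Real.exp_pos _)).le)
    (exp_mix_le hw ht ω) hs

lemma tsum_exp_mix_pos [Nonempty X] (hw : ∀ x, 0 < w x) {t : ℝ} (ht : t ∈ Icc (0 : ℝ) 1) {ω : Ω}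
    (hs : Summable fun x => w x * Real.exp (|g₁ x ω| + |g₂ x ω|)) :
    0 < ∑' x, w x * Real.exp (mix t (g₁ x ω) (g₂ x ω)) :=
  (summable_exp_mix hw ht hs).tsum_pos (fun x => (mul_pos (hw x) (Real.exp_pos _)).le)
    (Classical.arbitrary X) (mul_pos (hw _) (Real.exp_pos _))

end Mix

variable {Ω X : Type*} [MeasurableSpace Ω] [Countable X] {P : Measure Ω} {g₁ g₂ : X → Ω → ℝ}
  {D : X → X → ℝ} {d K V : ℝ} {w : X → ℝ}

lemma lintegral_tsum_exp_le (hg : GaussianPair P g₁ g₂ D d K V) (hw : ∀ x, 0 < w x)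
    (hws : Summable w) :
    ∫⁻ ω, ∑' x, ENNReal.ofReal (w x * Real.exp (|g₁ x ω| + |g₂ x ω|)) ∂P ≤
      ENNReal.ofReal ((∑' x, w x) * (2 * Real.exp (2 * V))) := by
  have := hg.measurable₁
  have := hg.measurable₂
  rw [lintegral_tsum fun x => by fun_prop, ← tsum_mul_right, ENNReal.ofReal_tsum_of_nonneg
    (fun x => mul_nonneg (hw x).le (by positivity)) (hws.mul_right _)]
  refine ENNReal.tsum_le_tsum fun x => ?_
  rw [← ofReal_integral_eq_lintegral_ofReal ((hg.integrable_exp_abs x).const_mul _)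
    (.of_forall fun ω => mul_nonneg (hw x).le (Real.exp_pos _).le), integral_const_mul]
  exact ENNReal.ofReal_le_ofReal (mul_le_mul_of_nonneg_left (hg.integral_exp_abs_le x) (hw x).le)

lemma ae_summable_exp (hg : GaussianPair P g₁ g₂ D d K V) (hw : ∀ x, 0 < w x) (hws : Summable w) :
    ∀ᵐ ω ∂P, Summable fun x => w x * Real.exp (|g₁ x ω| + |g₂ x ω|) := by
  have := hg.measurable₁
  have := hg.measurable₂
  have h := ae_lt_top (by fun_prop) ((hg.lintegral_tsum_exp_le hw hws).trans_lt
    ENNReal.ofReal_lt_top).ne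
  filter_upwards [h] with ω hω
  have := ENNReal.summable_toReal hω.ne
  simpa [ENNReal.toReal_ofReal (mul_nonneg (hw _).le (Real.exp_pos _).le)] using this

lemma integrable_tsum_exp (hg : GaussianPair P g₁ g₂ D d K V) (hw : ∀ x, 0 < w x)
    (hws : Summable w) : Integrable (fun ω => ∑' x, w x * Real.exp (|g₁ x ω| + |g₂ x ω|)) P := by
  have := hg.measurable₁
  have := hg.measurable₂
  have h := integrable_toReal_of_lintegral_ne_top (by fun_prop)
    ((hg.lintegral_tsum_exp_le hw hws).trans_lt ENNReal.ofReal_lt_top).ne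
  refine h.congr (.of_forall fun ω => ?_)
  simp only [ENNReal.tsum_toReal_eq fun x => ENNReal.ofReal_ne_top,
    ENNReal.toReal_ofReal (mul_nonneg (hw _).le (Real.exp_pos _).le)]

variable [Nonempty X]

/-- Dominated convergence along finite subsets. Once `s` contains a fixed point `x₀`, its single
term bounds the logarithm from below uniformly in `s`; the full series bounds it from above. -/
lemma tendsto_integral_log_sum (hg : GaussianPair P g₁ g₂ D d K V) (hw : ∀ x, 0 < w x)
    (hws : Summable w) {t : ℝ} (ht : t ∈ Icc (0 : ℝ) 1) :
    Filter.Tendsto (fun s : Finset X => ∫ ω, Real.log (∑ x : s,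
        w x * Real.exp (mix t (g₁ x ω) (g₂ x ω))) ∂P) Filter.atTop
      (𝓝 (∫ ω, Real.log (∑' x, w x * Real.exp (mix t (g₁ x ω) (g₂ x ω))) ∂P)) := by
  have := hg.isProbabilityMeasure
  let x₀ : X := Classical.arbitrary X
  refine tendsto_integral_filter_of_dominated_convergence
    (fun ω => ∑' x, w x * Real.exp (|g₁ x ω| + |g₂ x ω|) + |Real.log (w x₀)|
      + (|g₁ x₀ ω| + |g₂ x₀ ω|)) (.of_forall fun s => ?_) ?_ ?_ ?_
  · exact ((hg.comp ((↑) : s → X)).measurable_log_sum (w := fun x : s => w x) t).aestronglyMeasurable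
  · filter_upwards [Filter.eventually_ge_atTop {x₀}] with s hs
    have hx₀ : x₀ ∈ s := hs (Finset.mem_singleton_self _)
    have : Nonempty s := ⟨⟨x₀, hx₀⟩⟩
    filter_upwards [hg.ae_summable_exp hw hws] with ω hω
    refine (abs_log_sum_exp_le (w := fun x : s => w x) (fun x => hw x)
      (e := fun x : s => |g₁ x ω| + |g₂ x ω|) (fun x => abs_mix_le ht _ _) ⟨x₀, hx₀⟩).trans ?_
    gcongr
    rw [Finset.sum_coe_sort s fun x => w x * Real.exp (|g₁ x ω| + |g₂ x ω|)]
    exact hω.sum_le_tsum s fun x _ => (mul_pos (hw x) (Real.exp_pos _)).le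
  · exact ((hg.integrable_tsum_exp hw hws).add (integrable_const _)).add
      ((hg.hasGaussianLaw₁ x₀).integrable.abs.add (hg.hasGaussianLaw₂ x₀).integrable.abs)
  · filter_upwards [hg.ae_summable_exp hw hws] with ω hω
    have h1 : ∀ s : Finset X, ∑ x : s, w x * Real.exp (mix t (g₁ x ω) (g₂ x ω)) =
        ∑ x ∈ s, w x * Real.exp (mix t (g₁ x ω) (g₂ x ω)) := fun s =>
      Finset.sum_coe_sort s fun x => w x * Real.exp (mix t (g₁ x ω) (g₂ x ω))
    simp only [h1]
    exact (summable_exp_mix hw ht hω).hasSum.log (tsum_exp_mix_pos hw ht hω).ne'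

lemma tendsto_integral_softmax (hg : GaussianPair P g₁ g₂ D d K V) (hw : ∀ x, 0 < w x)
    (hws : Summable w) {t : ℝ} (ht : t ∈ Icc (0 : ℝ) 1) :
    Filter.Tendsto (fun s : Finset X => ∫ ω, ∑ x : s, ∑ y : s,
        softmax (fun x : s => w x) (fun y : s => mix t (g₁ y ω) (g₂ y ω)) x *
        softmax (fun x : s => w x) (fun y : s => mix t (g₁ y ω) (g₂ y ω)) y * D x y ∂P) Filter.atTop
      (𝓝 (∫ ω, pairAverage (fun x => w x * Real.exp (mix t (g₁ x ω) (g₂ x ω))) D ∂P)) := by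
  have := hg.isProbabilityMeasure
  let x₀ : X := Classical.arbitrary X
  refine tendsto_integral_filter_of_dominated_convergence (fun _ => K) (.of_forall fun s => ?_) ?_
    (integrable_const K) ?_
  · have hsm : ∀ x : s, Measurable fun ω =>
        softmax (fun x : s => w x) (fun y : s => mix t (g₁ y ω) (g₂ y ω)) x :=
      fun x => (measurable_softmax (w := fun x : s => w x) x).comp
        (measurable_pi_lambda _ fun y => hg.measurable_mix t y)
    exact (by fun_prop : Measurable _).aestronglyMeasurable
  · filter_upwards [Filter.eventually_ge_atTop {x₀}] with s hs
    have : Nonempty s := ⟨⟨x₀, hs (Finset.mem_singleton_self _)⟩⟩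
    refine .of_forall fun ω => ?_
    simp only [mul_assoc, ← Finset.mul_sum]
    exact abs_sum_softmax_mul_le (fun x : s => hw x) _ fun x =>
      abs_sum_softmax_mul_le (fun x : s => hw x) _ fun y => hg.bound x y
  · filter_upwards [hg.ae_summable_exp hw hws] with ω hω
    have h1 := tendsto_pairAverage (fun x => (mul_pos (hw x) (Real.exp_pos _)).le)
      (summable_exp_mix hw ht hω) (tsum_exp_mix_pos hw ht hω) hg.bound
    refine h1.congr fun s => ?_
    exact (sum_softmax_mul_subtype w (fun x => mix t (g₁ x ω) (g₂ x ω)) s D).symm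

lemma continuousOn_integral_pairAverage (hg : GaussianPair P g₁ g₂ D d K V) (hw : ∀ x, 0 < w x)
    (hws : Summable w) {f : X → X → ℝ} {K' : ℝ} (hf : ∀ x y, |f x y| ≤ K') :
    ContinuousOn (fun t => ∫ ω, pairAverage
      (fun x => w x * Real.exp (mix t (g₁ x ω) (g₂ x ω))) f ∂P) (Icc 0 1) := by
  have := hg.isProbabilityMeasure
  refine continuousOn_of_dominated (bound := fun _ => K') (fun t _ => ?_) (fun t ht => ?_)
    (integrable_const _) ?_
  · refine (measurable_pairAverage fun x => ?_).aestronglyMeasurable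
    have := hg.measurable_mix t x
    fun_prop
  · filter_upwards [hg.ae_summable_exp hw hws] with ω hω
    exact abs_pairAverage_le (fun x => (mul_pos (hw x) (Real.exp_pos _)).le)
      (summable_exp_mix hw ht hω) (tsum_exp_mix_pos hw ht hω) hf
  · filter_upwards [hg.ae_summable_exp hw hws] with ω hω
    exact continuousOn_pairAverage (fun t _ x => (mul_pos (hw x) (Real.exp_pos _)).le)
      (fun x => (((continuous_mix _ _).rexp).const_mul _).continuousOn) hω
      (fun t ht x => exp_mix_le hw ht ω x) (fun t ht => tsum_exp_mix_pos hw ht hω) hf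

lemma abs_integral_pairAverage_le (hg : GaussianPair P g₁ g₂ D d K V) (hw : ∀ x, 0 < w x)
    (hws : Summable w) {f : X → X → ℝ} {K' : ℝ} (hf : ∀ x y, |f x y| ≤ K') {t : ℝ}
    (ht : t ∈ Icc (0 : ℝ) 1) :
    |∫ ω, pairAverage (fun x => w x * Real.exp (mix t (g₁ x ω) (g₂ x ω))) f ∂P| ≤ K' := by
  have := hg.isProbabilityMeasure
  have h : ∀ᵐ ω ∂P,
      ‖pairAverage (fun x => w x * Real.exp (mix t (g₁ x ω) (g₂ x ω))) f‖ ≤ K' := by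
    filter_upwards [hg.ae_summable_exp hw hws] with ω hω
    exact abs_pairAverage_le (fun x => (mul_pos (hw x) (Real.exp_pos _)).le)
      (summable_exp_mix hw ht hω) (tsum_exp_mix_pos hw ht hω) hf
  simpa using norm_integral_le_of_norm_le_const h

/-- The integrated form of the Gaussian interpolation formula for fixed summable weights. -/
lemma integral_log_tsum_sub (hg : GaussianPair P g₁ g₂ D d K V) (hw : ∀ x, 0 < w x)
    (hws : Summable w) {a b : ℝ} (ha : 0 ≤ a) (hab : a ≤ b) (hb : b ≤ 1) :
    ∫ t in a..b, (d / 2 - (1 / 2) * ∫ ω, pairAverage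
        (fun x => w x * Real.exp (mix t (g₁ x ω) (g₂ x ω))) D ∂P) =
      ∫ ω, Real.log (∑' x, w x * Real.exp (mix b (g₁ x ω) (g₂ x ω))) ∂P -
      ∫ ω, Real.log (∑' x, w x * Real.exp (mix a (g₁ x ω) (g₂ x ω))) ∂P := by
  have := hg.isProbabilityMeasure
  let x₀ : X := Classical.arbitrary X
  have hev : ∀ᶠ s : Finset X in Filter.atTop, Nonempty s := by
    filter_upwards [Filter.eventually_ge_atTop {x₀}] with s hs
    exact ⟨⟨x₀, hs (Finset.mem_singleton_self _)⟩⟩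
  have hlim := (hg.tendsto_integral_log_sum hw hws ⟨ha.trans hab, hb⟩).sub
    (hg.tendsto_integral_log_sum hw hws ⟨ha, hab.trans hb⟩)
  -- Both sides are limits of the finite formula; the time integrands are dominated by a constant
  -- independent of `s`.
  refine tendsto_nhds_unique ?_ hlim
  have hlim' : Filter.Tendsto (fun s : Finset X => ∫ t in a..b, (d / 2 - (1 / 2) * ∫ ω,
      ∑ x : s, ∑ y : s,
        softmax (fun x : s => w x) (fun y : s => mix t (g₁ y ω) (g₂ y ω)) x *
        softmax (fun x : s => w x) (fun y : s => mix t (g₁ y ω) (g₂ y ω)) y * D x y ∂P))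
      Filter.atTop (𝓝 (∫ t in a..b, (d / 2 - (1 / 2) * ∫ ω, pairAverage
        (fun x => w x * Real.exp (mix t (g₁ x ω) (g₂ x ω))) D ∂P))) := by
    refine intervalIntegral.tendsto_integral_filter_of_dominated_convergence
      (fun _ => |d| / 2 + K / 2) ?_ ?_ (by simp) (.of_forall fun t ht => ?_)
    · filter_upwards [hev] with s hs
      exact (continuous_const.sub (((hg.comp ((↑) : s → X)).continuous_integral_softmax
        (w := fun x : s => w x) fun x => hw x).const_mul _)).aestronglyMeasurable
    · filter_upwards [hev] with s hs
      refine .of_forall fun t _ => ?_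
      have h : |∫ ω, ∑ x : s, ∑ y : s,
          softmax (fun x : s => w x) (fun y : s => mix t (g₁ y ω) (g₂ y ω)) x *
          softmax (fun x : s => w x) (fun y : s => mix t (g₁ y ω) (g₂ y ω)) y * D x y ∂P| ≤ K := by
        have h : ∀ᵐ ω ∂P, ‖∑ x : s, ∑ y : s,
          softmax (fun x : s => w x) (fun y : s => mix t (g₁ y ω) (g₂ y ω)) x *
          softmax (fun x : s => w x) (fun y : s => mix t (g₁ y ω) (g₂ y ω)) y * D x y‖ ≤ K := by
          refine .of_forall fun ω => ?_
          simp only [mul_assoc, ← Finset.mul_sum]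
          exact abs_sum_softmax_mul_le (fun x : s => hw x) _ fun x =>
            abs_sum_softmax_mul_le (fun x : s => hw x) _ fun y => hg.bound x y
        simpa using norm_integral_le_of_norm_le_const h
      refine (norm_sub_le _ _).trans ?_
      rw [Real.norm_eq_abs, Real.norm_eq_abs, abs_div, abs_mul, abs_two,
        abs_of_pos (one_half_pos (α := ℝ))]
      linarith
    · rw [uIoc_of_le hab] at ht
      exact ((hg.tendsto_integral_softmax hw hws ⟨ha.trans ht.1.le, ht.2.trans hb⟩).const_mul
        _).const_sub _
  refine hlim'.congr' ?_
  filter_upwards [hev] with s hs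
  exact (hg.comp ((↑) : s → X)).integral_log_sum_sub (w := fun x : s => w x) (fun x => hw x)
    ha hab hb

/-- The integrated formula has an integrand continuous up to 0 and 1, so differentiating it back
also yields the one-sided derivatives. -/
lemma hasDerivWithinAt_integral_log_tsum (hg : GaussianPair P g₁ g₂ D d K V) (hw : ∀ x, 0 < w x)
    (hws : Summable w) {t : ℝ} (ht : t ∈ Icc (0 : ℝ) 1) :
    HasDerivWithinAt
      (fun t => ∫ ω, Real.log (∑' x, w x * Real.exp (mix t (g₁ x ω) (g₂ x ω))) ∂P)
      (d / 2 - (1 / 2) * ∫ ω, pairAverage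
        (fun x => w x * Real.exp (mix t (g₁ x ω) (g₂ x ω))) D ∂P) (Icc 0 1) t := by
  set ψ : ℝ → ℝ := fun t => d / 2 - (1 / 2) * ∫ ω, pairAverage
    (fun x => w x * Real.exp (mix t (g₁ x ω) (g₂ x ω))) D ∂P with hψ
  set F : ℝ → ℝ := fun t =>
    ∫ ω, Real.log (∑' x, w x * Real.exp (mix t (g₁ x ω) (g₂ x ω))) ∂P with hF
  have hψc : ContinuousOn ψ (Icc 0 1) :=
    continuousOn_const.sub ((hg.continuousOn_integral_pairAverage hw hws hg.bound).const_mul _)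
  -- The constant continuation outside `[0, 1]` makes the integrand continuous on `ℝ`, so that the
  -- two-sided fundamental theorem applies.
  set ψ' : ℝ → ℝ := IccExtend zero_le_one ((Icc (0 : ℝ) 1).domRestrict ψ) with hψ'
  have hψ'c : Continuous ψ' := (continuousOn_iff_continuous_domRestrict.1 hψc).Icc_extend'
  have heq : ∀ s ∈ Icc (0 : ℝ) 1, ψ' s = ψ s := fun s hs =>
    IccExtend_of_mem zero_le_one _ hs
  have hFs : ∀ s ∈ Icc (0 : ℝ) 1, F s = F 0 + ∫ r in (0 : ℝ)..s, ψ' r := fun s hs => by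
    have h1 := hg.integral_log_tsum_sub hw hws le_rfl hs.1 hs.2
    have h2 : ∫ r in (0 : ℝ)..s, ψ' r = ∫ r in (0 : ℝ)..s, ψ r := by
      refine intervalIntegral.integral_congr fun r hr => ?_
      rw [uIcc_of_le hs.1] at hr
      exact heq r ⟨hr.1, hr.2.trans hs.2⟩
    rw [h2]
    linarith
  have hd : HasDerivAt (fun s => F 0 + ∫ r in (0 : ℝ)..s, ψ' r) (ψ' t) t :=
    ((hψ'c.integral_hasStrictDerivAt 0 t).hasDerivAt).const_add _
  rw [heq t ht] at hd
  exact hd.hasDerivWithinAt.congr hFs (hFs t ht)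

/-- The derivative is bounded by a number in which `w` does not appear. This uniformity allows
differentiation after averaging over random weights. -/
lemma abs_integral_log_tsum_sub_le (hg : GaussianPair P g₁ g₂ D d K V) (hw : ∀ x, 0 < w x)
    (hws : Summable w) {s t : ℝ} (hs : s ∈ Icc (0 : ℝ) 1) (ht : t ∈ Icc (0 : ℝ) 1) :
    |∫ ω, Real.log (∑' x, w x * Real.exp (mix t (g₁ x ω) (g₂ x ω))) ∂P -
      ∫ ω, Real.log (∑' x, w x * Real.exp (mix s (g₁ x ω) (g₂ x ω))) ∂P| ≤
      (|d| / 2 + K / 2) * |t - s| := by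
  refine (convex_Icc (0 : ℝ) 1).norm_image_sub_le_of_norm_hasDerivWithin_le
    (fun r hr => hg.hasDerivWithinAt_integral_log_tsum hw hws hr) (fun r hr => ?_) hs ht
  refine (norm_sub_le _ _).trans ?_
  rw [Real.norm_eq_abs, Real.norm_eq_abs, abs_div, abs_mul, abs_two,
        abs_of_pos (one_half_pos (α := ℝ))]
  have := hg.abs_integral_pairAverage_le hw hws hg.bound hr
  linarith

end GaussianPair

/-! ### The tree metric -/

section Tree

variable {k : ℕ}

lemma treeMeet_self (α : Fin k → ℕ) : treeMeet α α = k + 1 := by simp [treeMeet]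

lemma treeMeet_mem {α β : Fin k → ℕ} (h : α ≠ β) :
    ∃ j : Fin k, α j ≠ β j ∧ treeMeet α β = (j : ℕ) + 1 := by
  rw [treeMeet, if_neg h]
  obtain ⟨j, hj⟩ := Function.ne_iff.1 h
  exact Nat.sInf_mem (s := {l : ℕ | ∃ j : Fin k, α j ≠ β j ∧ l = (j : ℕ) + 1})
    ⟨(j : ℕ) + 1, j, hj, rfl⟩

lemma treeMeet_le (α β : Fin k → ℕ) : treeMeet α β ≤ k + 1 := by
  by_cases h : α = β
  · rw [h, treeMeet_self]
  · obtain ⟨j, -, hj⟩ := treeMeet_mem h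
    omega

/-- The meet is the 1-based position of the first disagreement, hence the strict inequality; the
value `k + 1` for equal leaves fits the same rule. -/
lemma leafPrefix_eq_iff (α β : Fin k → ℕ) {l : ℕ} (hl : l ≤ k) :
    leafPrefix α l hl = leafPrefix β l hl ↔ l < treeMeet α β := by
  by_cases h : α = β
  · subst h
    rw [treeMeet_self]
    exact ⟨fun _ => by omega, fun _ => rfl⟩
  obtain ⟨j, hj, hm⟩ := treeMeet_mem h
  constructor
  · intro he
    by_contra hlt
    have hjl : (j : ℕ) < l := by omega
    exact hj (congrFun he ⟨j, hjl⟩)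
  · intro hlt
    funext i
    by_contra hi
    have : treeMeet α β ≤ (i : ℕ) + 1 := by
      rw [treeMeet, if_neg h]
      exact Nat.sInf_le ⟨Fin.castLE hl i, hi, rfl⟩
    omega

/-- Two leaves share exactly the vertices at levels below their meet, the root included, so the
increments of `F` telescope. -/
lemma sum_leafPrefix_eq (α β : Fin k → ℕ) (F : ℕ → ℝ) :
    ∑ l : Fin (k + 1), (if leafPrefix α l (Nat.lt_succ_iff.mp l.isLt) =
      leafPrefix β l (Nat.lt_succ_iff.mp l.isLt) then F ((l : ℕ) + 1) - F l else 0) =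
      F (treeMeet α β) - F 0 := by
  simp only [leafPrefix_eq_iff]
  rw [Fin.sum_univ_eq_sum_range
    (fun l => if l < treeMeet α β then F (l + 1) - F l else 0) (k + 1), ← Finset.sum_filter]
  have : (Finset.range (k + 1)).filter (· < treeMeet α β) = Finset.range (treeMeet α β) := by
    have := treeMeet_le α β
    ext l
    simp only [Finset.mem_filter, Finset.mem_range]
    omega
  rw [this, Finset.sum_range_sub]

end Tree

lemma spin_mul_self {N : ℕ} (σ : SpinConfig N) (i : Fin N) : spin σ i * spin σ i = 1 := by
  rcases Int.units_eq_one_or (σ i) with h | h <;> simp [spin, h]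

lemma overlap_self {N : ℕ} (hN : 1 ≤ N) (σ : SpinConfig N) : overlap σ σ = 1 := by
  have : (N : ℝ) ≠ 0 := by positivity
  simp [overlap, spin_mul_self, this]

/-! ### Joint Gaussianity -/

lemma ProbabilityTheory.IsGaussianProcess.sumElim {Ω S T : Type*} [MeasurableSpace Ω]
    {P : Measure Ω} {X : S → Ω → ℝ} {Y : T → Ω → ℝ} (hX : IsGaussianProcess X P)
    (hY : IsGaussianProcess Y P) (h : IndepFun (fun ω s => X s ω) (fun ω t => Y t ω) P) :
    IsGaussianProcess (Sum.elim X Y) P where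
  hasGaussianLaw I := by
    classical
    have hind : IndepFun (fun ω => I.toLeft.restrict (X · ω)) (fun ω => I.toRight.restrict (Y · ω))
        P := h.comp (φ := I.toLeft.restrict) (ψ := I.toRight.restrict)
          (Finset.measurable_restrict _) (Finset.measurable_restrict _)
    have hpair := hind.hasGaussianLaw (hX.hasGaussianLaw _) (hY.hasGaussianLaw _)
    let L : (I.toLeft → ℝ) × (I.toRight → ℝ) →L[ℝ] (I → ℝ) := ContinuousLinearMap.pi fun i =>
      match i with
      | ⟨Sum.inl s, hs⟩ => (ContinuousLinearMap.proj (R := ℝ) (φ := fun _ : I.toLeft => ℝ)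
          ⟨s, Finset.mem_toLeft.2 hs⟩).comp (ContinuousLinearMap.fst ℝ _ _)
      | ⟨Sum.inr t, ht⟩ => (ContinuousLinearMap.proj (R := ℝ) (φ := fun _ : I.toRight => ℝ)
          ⟨t, Finset.mem_toRight.2 ht⟩).comp (ContinuousLinearMap.snd ℝ _ _)
    have := hpair.map_fun L
    convert! this using 1
    funext ω i
    rcases i with ⟨s | t, hi⟩ <;> rfl

/-! ### Covariances of the Hamiltonian and of the tree field -/

section Model

variable {Ω : Type*} [MeasurableSpace Ω] {P : Measure Ω} {N k : ℕ} {ξ : ℝ → ℝ} {q : ℕ → ℝ}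

/-- The variables `z` indexed by a single set. -/
def treeNoise (z : (l : Fin (k + 1)) → (Fin l → ℕ) → Fin N → Ω → ℝ)
    (a : ((l : Fin (k + 1)) × (Fin l → ℕ)) × Fin N) : Ω → ℝ := z a.1.1 a.1.2 a.2

/-- The vertex of level `l` on the path to the leaf `α`, together with the coordinate `i`. -/
def pathIndex (α : Fin k → ℕ) (p : Fin N × Fin (k + 1)) :
    ((l : Fin (k + 1)) × (Fin l → ℕ)) × Fin N :=
  (⟨p.2, leafPrefix α p.2 (Nat.lt_succ_iff.mp p.2.isLt)⟩, p.1)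

/-- The external field `∑ᵢ sᵢ^α σᵢ`. -/
def treeField (z : (l : Fin (k + 1)) → (Fin l → ℕ) → Fin N → Ω → ℝ)
    (x : SpinConfig N × (Fin k → ℕ)) (ω : Ω) : ℝ :=
  ∑ i, pathSum z x.2 i ω * spin x.1 i

variable {z : (l : Fin (k + 1)) → (Fin l → ℕ) → Fin N → Ω → ℝ}

omit [MeasurableSpace Ω] in
lemma treeField_eq (x : SpinConfig N × (Fin k → ℕ)) (ω : Ω) :
    treeField z x ω =
      ∑ p : Fin N × Fin (k + 1), spin x.1 p.1 * treeNoise z (pathIndex x.2 p) ω := by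
  rw [treeField, Fintype.sum_prod_type]
  refine Finset.sum_congr rfl fun i _ => ?_
  rw [pathSum, mul_comm, Finset.mul_sum]
  rfl

lemma IsTreeGaussian.integral_mul (hz : IsTreeGaussian P ξ q z)
    (hmono : ∀ l ≤ k, deriv ξ (q l) ≤ deriv ξ (q (l + 1))) (α β : Fin k → ℕ)
    (p p' : Fin N × Fin (k + 1)) :
    ∫ ω, treeNoise z (pathIndex α p) ω * treeNoise z (pathIndex β p') ω ∂P =
      if p = p' then (if leafPrefix α p.2 (Nat.lt_succ_iff.mp p.2.isLt) =
        leafPrefix β p.2 (Nat.lt_succ_iff.mp p.2.isLt) then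
          deriv ξ (q ((p.2 : ℕ) + 1)) - deriv ξ (q p.2) else 0) else 0 := by
  have hlaw : ∀ a, HasLaw (treeNoise z a) (gaussianReal 0
      (deriv ξ (q ((a.1.1 : ℕ) + 1)) - deriv ξ (q (a.1.1 : ℕ))).toNNReal) P :=
    fun a => hz.law a.1.1 a.1.2 a.2
  have hmean : ∀ a, ∫ ω, treeNoise z a ω ∂P = 0 := fun a => by
    rw [(hlaw a).integral_eq, integral_id_gaussianReal]
  by_cases h : pathIndex α p = pathIndex β p'
  · have h1 : p.1 = p'.1 := congrArg Prod.snd h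
    have h2 : p.2 = p'.2 := congrArg (fun a => a.1.1) h
    obtain rfl : p = p' := Prod.ext h1 h2
    have h3 : leafPrefix α p.2 (Nat.lt_succ_iff.mp p.2.isLt) =
        leafPrefix β p.2 (Nat.lt_succ_iff.mp p.2.isLt) := by
      have := congrArg Prod.fst h
      simpa [pathIndex] using this
    rw [if_pos rfl, if_pos h3, ← h]
    have hv := (hlaw (pathIndex α p)).variance_eq
    rw [variance_id_gaussianReal, variance_of_integral_eq_zero
      (hlaw _).aemeasurable (hmean _)] at hv
    simp only [← sq]
    -- The variance in the law is truncated at zero by `toNNReal`; monotonicity of `ξ'` along `q`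
    -- makes the truncation harmless.
    refine hv.trans (Real.coe_toNNReal _ (sub_nonneg.2 (hmono _ ?_)))
    exact Nat.lt_succ_iff.mp p.2.isLt
  · have hind := hz.indep.indepFun h
    have : (if p = p' then (if leafPrefix α p.2 (Nat.lt_succ_iff.mp p.2.isLt) =
        leafPrefix β p.2 (Nat.lt_succ_iff.mp p.2.isLt) then
          deriv ξ (q ((p.2 : ℕ) + 1)) - deriv ξ (q p.2) else 0) else 0) = 0 := by
      by_cases hp : p = p'
      · subst hp
        rw [if_pos rfl, if_neg fun he => h ?_]
        simp [pathIndex, he]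
      · rw [if_neg hp]
    rw [this]
    have := hind.integral_fun_mul_eq_mul_integral
      (hz.measurable _ _ _).aestronglyMeasurable (hz.measurable _ _ _).aestronglyMeasurable
    refine this.trans ?_
    have h0 := hmean (pathIndex α p)
    rw [treeNoise] at h0
    rw [h0, zero_mul]

lemma IsTreeGaussian.hasGaussianLaw (hz : IsTreeGaussian P ξ q z)
    (a : ((l : Fin (k + 1)) × (Fin l → ℕ)) × Fin N) : HasGaussianLaw (treeNoise z a) P :=
  (hz.law a.1.1 a.1.2 a.2).hasGaussianLaw

lemma IsTreeGaussian.gaussian_treeNoise (hz : IsTreeGaussian P ξ q z) :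
    IsGaussianProcess (treeNoise z) P where
  hasGaussianLaw I :=
    (hz.indep.precomp (Subtype.val_injective (p := fun a => a ∈ I))).hasGaussianLaw
      fun i => hz.hasGaussianLaw i

lemma IsTreeGaussian.measurable_treeField (hz : IsTreeGaussian P ξ q z)
    (x : SpinConfig N × (Fin k → ℕ)) : Measurable (treeField z x) := by
  have := hz.measurable
  unfold treeField pathSum
  fun_prop

lemma IsTreeGaussian.integral_treeField (hz : IsTreeGaussian P ξ q z)
    (x : SpinConfig N × (Fin k → ℕ)) : ∫ ω, treeField z x ω ∂P = 0 := by
  simp only [treeField_eq]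
  rw [integral_finsetSum _ fun p _ => (hz.hasGaussianLaw _).integrable.const_mul _]
  refine Finset.sum_eq_zero fun p _ => ?_
  rw [integral_const_mul]
  have : ∫ ω, treeNoise z (pathIndex x.2 p) ω ∂P = 0 := by
    rw [treeNoise, (hz.law _ _ _).integral_eq, integral_id_gaussianReal]
  rw [this, mul_zero]

/-- Only equal coordinates at shared vertices correlate. Their variances telescope to `ξ'(q_{α∧β})`,
with no lower term since `ξ'(q_0) = 0`, and the spins sum to `N` times the overlap. -/
lemma IsTreeGaussian.covariance_treeField (hz : IsTreeGaussian P ξ q z) (hN : 1 ≤ N)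
    (hmono : ∀ l ≤ k, deriv ξ (q l) ≤ deriv ξ (q (l + 1))) (h0 : deriv ξ (q 0) = 0)
    (x y : SpinConfig N × (Fin k → ℕ)) :
    ∫ ω, treeField z x ω * treeField z y ω ∂P =
      N * (overlap x.1 y.1 * deriv ξ (q (treeMeet x.2 y.2))) := by
  have hN0 : (N : ℝ) ≠ 0 := by positivity
  have hint : ∀ a b, Integrable (fun ω => treeNoise z a ω * treeNoise z b ω) P := fun a b =>
    (hz.hasGaussianLaw a).memLp_two.integrable_mul (hz.hasGaussianLaw b).memLp_two
  have hexp : ∀ ω, treeField z x ω * treeField z y ω =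
      ∑ p : Fin N × Fin (k + 1), ∑ p' : Fin N × Fin (k + 1), spin x.1 p.1 * spin y.1 p'.1 *
        (treeNoise z (pathIndex x.2 p) ω * treeNoise z (pathIndex y.2 p') ω) := fun ω => by
    rw [treeField_eq, treeField_eq, Finset.sum_mul_sum]
    exact Finset.sum_congr rfl fun p _ => Finset.sum_congr rfl fun p' _ => by ring
  simp only [hexp]
  rw [integral_finsetSum _ fun p _ => integrable_finsetSum _ fun p' _ => (hint _ _).const_mul _]
  have hin : ∀ p : Fin N × Fin (k + 1), ∫ ω, ∑ p' : Fin N × Fin (k + 1),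
      spin x.1 p.1 * spin y.1 p'.1 *
        (treeNoise z (pathIndex x.2 p) ω * treeNoise z (pathIndex y.2 p') ω) ∂P =
      spin x.1 p.1 * spin y.1 p.1 * (if leafPrefix x.2 p.2 (Nat.lt_succ_iff.mp p.2.isLt) =
        leafPrefix y.2 p.2 (Nat.lt_succ_iff.mp p.2.isLt) then
          deriv ξ (q ((p.2 : ℕ) + 1)) - deriv ξ (q p.2) else 0) := fun p => by
    rw [integral_finsetSum _ fun p' _ => (hint _ _).const_mul _]
    simp only [integral_const_mul, hz.integral_mul hmono]
    rw [Finset.sum_eq_single p (fun p' _ hp => by rw [if_neg (Ne.symm hp), mul_zero])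
      (fun h => absurd (Finset.mem_univ p) h), if_pos rfl]
  simp only [hin]
  rw [Fintype.sum_prod_type]
  simp only [← Finset.mul_sum]
  have htel := sum_leafPrefix_eq x.2 y.2 fun l => deriv ξ (q l)
  simp only [h0, sub_zero] at htel
  simp only [htel, overlap]
  rw [← Finset.sum_mul]
  field_simp

/-- Both processes are finite linear combinations of the jointly Gaussian family formed by `H` and
`z`. -/
lemma isGaussianProcess_sumElim_treeField {H : SpinConfig N → Ω → ℝ}
    (hH : IsGaussianHamiltonian P ξ H) (hz : IsTreeGaussian P ξ q z)
    (hind : IndepFun (fun ω σ => H σ ω) (fun ω l a i => z l a i ω) P) :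
    IsGaussianProcess (Sum.elim (fun x : SpinConfig N × (Fin k → ℕ) => H x.1) (treeField z)) P := by
  classical
  have hHp : IsGaussianProcess H P := ⟨fun I => hH.gaussian.map_fun
    (ContinuousLinearMap.pi fun i : I => ContinuousLinearMap.proj (R := ℝ)
      (φ := fun _ : SpinConfig N => ℝ) i.1)⟩
  have hind' : IndepFun (fun ω σ => H σ ω) (fun ω a => treeNoise z a ω) P :=
    hind.comp (φ := id) (ψ := fun (f : (l : Fin (k + 1)) → (Fin l → ℕ) → Fin N → ℝ)
      (a : ((l : Fin (k + 1)) × (Fin l → ℕ)) × Fin N) => f a.1.1 a.1.2 a.2)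
      measurable_id (by fun_prop)
  have hsum := hHp.sumElim hz.gaussian_treeNoise hind'
  refine IsGaussianProcess.of_isGaussianProcess hsum fun s => ?_
  rcases s with x | x
  · exact ⟨{Sum.inl x.1}, ContinuousLinearMap.proj ⟨Sum.inl x.1, by simp⟩, fun ω => rfl⟩
  · refine ⟨Finset.univ.image fun p => Sum.inr (pathIndex x.2 p),
      ∑ p : Fin N × Fin (k + 1), spin x.1 p.1 • ContinuousLinearMap.proj
        ⟨Sum.inr (pathIndex x.2 p), Finset.mem_image_of_mem _ (Finset.mem_univ p)⟩, fun ω => ?_⟩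
    rw [Sum.elim_inr, treeField_eq]
    simp

/-- The difference of the covariances of the two processes in the interpolation. -/
def covDiff (ξ : ℝ → ℝ) (q : ℕ → ℝ) (x y : SpinConfig N × (Fin k → ℕ)) : ℝ :=
  N * (deltaFn ξ (overlap x.1 y.1) (q (treeMeet x.2 y.2)) - thetaFn ξ (q (treeMeet x.2 y.2)))

/-- The `θ` terms cancel. Keeping them in `covDiff` is what separates the `Δ` average from the `θ`
average in the final formula. -/
lemma covDiff_eq (x y : SpinConfig N × (Fin k → ℕ)) : covDiff ξ q x y =
    N * ξ (overlap x.1 y.1) - N * (overlap x.1 y.1 * deriv ξ (q (treeMeet x.2 y.2))) := by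
  rw [covDiff, deltaFn]; ring

/-- The overlap and the meet take finitely many values, so no regularity of `f` is needed. -/
lemma exists_abs_le_of_overlap (q : ℕ → ℝ) (f : ℝ → ℝ → ℝ) :
    ∃ K, ∀ x y : SpinConfig N × (Fin k → ℕ),
      |f (overlap x.1 y.1) (q (treeMeet x.2 y.2))| ≤ K := by
  obtain ⟨K, hK⟩ := Finite.exists_le fun p : SpinConfig N × SpinConfig N × Fin (k + 2) =>
    |f (overlap p.1 p.2.1) (q p.2.2)|
  exact ⟨K, fun x y => hK (x.1, y.1, ⟨treeMeet x.2 y.2, by have := treeMeet_le x.2 y.2; omega⟩)⟩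

theorem exists_gaussianPair {H : SpinConfig N → Ω → ℝ} (hN : 1 ≤ N)
    (hH : IsGaussianHamiltonian P ξ H) (hz : IsTreeGaussian P ξ q z)
    (hind : IndepFun (fun ω σ => H σ ω) (fun ω l a i => z l a i ω) P)
    (hmono : ∀ l ≤ k, deriv ξ (q l) ≤ deriv ξ (q (l + 1))) (h0 : deriv ξ (q 0) = 0)
    (hq : q (k + 1) = 1) :
    ∃ K V, GaussianPair P (fun x : SpinConfig N × (Fin k → ℕ) => H x.1) (treeField z)
      (covDiff ξ q) (-N * thetaFn ξ 1) K V := by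
  have hP : IsProbabilityMeasure P := hH.gaussian.isProbabilityMeasure
  obtain ⟨K, hK⟩ := exists_abs_le_of_overlap (N := N) (k := k) q
    fun a b => N * (deltaFn ξ a b - thetaFn ξ b)
  -- The variances of the two processes are `N ξ(1)` and `N ξ'(1)`.
  refine ⟨K, N * (|ξ 1| + |deriv ξ 1|), ?_⟩
  have hcov := hz.covariance_treeField hN hmono h0
  constructor
  · exact fun x => hH.measurable x.1
  · exact hz.measurable_treeField
  · exact isGaussianProcess_sumElim_treeField hH hz hind
  · exact fun x => hH.mean_zero x.1
  · exact hz.integral_treeField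
  · intro x y
    have hxy : IndepFun (H x.1) (treeField z y) P :=
      hind.comp (φ := fun h : SpinConfig N → ℝ => h x.1)
        (ψ := fun f : (l : Fin (k + 1)) → (Fin l → ℕ) → Fin N → ℝ => ∑ i, (∑ l : Fin (k + 1),
          f l (leafPrefix y.2 l (Nat.lt_succ_iff.mp l.isLt)) i) * spin y.1 i)
        (measurable_pi_apply _) (by fun_prop)
    rw [hxy.integral_fun_mul_eq_mul_integral (hH.measurable _).aestronglyMeasurable
      (hz.measurable_treeField y).aestronglyMeasurable, hH.mean_zero, zero_mul]
  · intro x y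
    rw [hcov, hH.covariance, covDiff_eq]
  · intro x
    -- The diagonal is constant because the self-overlap is 1 and `q (k + 1) = 1`.
    rw [covDiff_eq, overlap_self hN, treeMeet_self, hq, thetaFn]
    ring
  · exact hK
  · intro x
    simp only [sq, hH.covariance, overlap_self hN]
    have := abs_nonneg (deriv ξ 1)
    have := le_abs_self (ξ 1)
    gcongr
    linarith
  · intro x
    simp only [sq, hcov, overlap_self hN, treeMeet_self, hq, one_mul]
    have := le_abs_self (deriv ξ 1)
    have := abs_nonneg (ξ 1)
    gcongr
    linarith

end Model

/-! ### Independence of the weights and the Gaussian fields -/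

/-- The joint law is the product of three laws, whose factors may be permuted and regrouped. It is
used to separate the weights from both Gaussian families at once. -/
lemma ProbabilityTheory.IndepFun.prodMk_of_indepFun {Ω A B C : Type*} [MeasurableSpace Ω]
    [MeasurableSpace A] [MeasurableSpace B] [MeasurableSpace C] {P : Measure Ω}
    [IsProbabilityMeasure P] {X : Ω → A} {Y : Ω → B} {Z : Ω → C} (hX : Measurable X)
    (hY : Measurable Y) (hZ : Measurable Z) (h : IndepFun X (fun ω => (Y ω, Z ω)) P)
    (hYZ : IndepFun Y Z P) : IndepFun Y (fun ω => (X ω, Z ω)) P := by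
  have := Measure.isProbabilityMeasure_map (μ := P) hX.aemeasurable
  have := Measure.isProbabilityMeasure_map (μ := P) hY.aemeasurable
  have := Measure.isProbabilityMeasure_map (μ := P) hZ.aemeasurable
  have hXZ : IndepFun X Z P := h.comp measurable_id measurable_snd
  have e1 := (indepFun_iff_map_prod_eq_prod_map_map hX.aemeasurable
    (hY.prodMk hZ).aemeasurable).1 h
  have e2 := (indepFun_iff_map_prod_eq_prod_map_map hY.aemeasurable hZ.aemeasurable).1 hYZ
  have e3 := (indepFun_iff_map_prod_eq_prod_map_map hX.aemeasurable hZ.aemeasurable).1 hXZ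
  refine (indepFun_iff_map_prod_eq_prod_map_map hY.aemeasurable (hX.prodMk hZ).aemeasurable).2 ?_
  rw [e2] at e1
  rw [e3]
  have p1 := (measurePreserving_prodAssoc (P.map X) (P.map Y) (P.map Z)).symm
  have p2 : MeasurePreserving (Prod.map Prod.swap id) (((P.map X).prod (P.map Y)).prod (P.map Z))
      (((P.map Y).prod (P.map X)).prod (P.map Z)) :=
    Measure.measurePreserving_swap.prod (MeasurePreserving.id _)
  have p3 := measurePreserving_prodAssoc (P.map Y) (P.map X) (P.map Z)
  have p := (p3.comp p2).comp p1
  rw [← p.map_eq, ← e1, Measure.map_map p.measurable (hX.prodMk (hY.prodMk hZ))]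
  rfl

/-! ### Independence as integration over a product space -/

section Transfer

variable {Ω A B : Type*} [MeasurableSpace Ω] [MeasurableSpace A] [MeasurableSpace B]
  {P : Measure Ω} [IsProbabilityMeasure P] {U : Ω → A} {G : Ω → B}

/-- Evaluating `G` at a second, independent sample point does not change the joint law. One point
then freezes the weights while the other averages over the fields. -/
lemma ProbabilityTheory.IndepFun.map_prod_eq (hU : Measurable U) (hG : Measurable G)
    (h : IndepFun U G P) :
    P.map (fun ω => (U ω, G ω)) = (P.prod P).map (fun p => (U p.1, G p.2)) := by
  rw [(indepFun_iff_map_prod_eq_prod_map_map hU.aemeasurable hG.aemeasurable).1 h,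
    Measure.map_prod_map P P hU hG]
  rfl

lemma ProbabilityTheory.IndepFun.lintegral_eq (hU : Measurable U) (hG : Measurable G)
    (h : IndepFun U G P) {f : A × B → ℝ≥0∞} (hf : Measurable f) :
    ∫⁻ ω, f (U ω, G ω) ∂P = ∫⁻ ω, ∫⁻ ω', f (U ω, G ω') ∂P ∂P := by
  rw [← lintegral_map (f := f) hf (hU.prodMk hG), h.map_prod_eq hU hG,
    lintegral_map hf (by fun_prop), lintegral_prod _ (by fun_prop)]

lemma ProbabilityTheory.IndepFun.integrable_comp_iff (hU : Measurable U) (hG : Measurable G)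
    (h : IndepFun U G P) {f : A × B → ℝ} (hf : Measurable f) :
    Integrable (fun ω => f (U ω, G ω)) P ↔
      Integrable (fun p : Ω × Ω => f (U p.1, G p.2)) (P.prod P) := by
  have h1 := integrable_map_measure (μ := P) (f := fun ω => (U ω, G ω)) (g := f)
    hf.aestronglyMeasurable (hU.prodMk hG).aemeasurable
  have h2 := integrable_map_measure (μ := P.prod P) (f := fun p : Ω × Ω => (U p.1, G p.2)) (g := f)
    hf.aestronglyMeasurable (by fun_prop)
  rw [h.map_prod_eq hU hG] at h1
  exact h1.symm.trans h2

lemma ProbabilityTheory.IndepFun.integral_eq_integral_integral (hU : Measurable U)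
    (hG : Measurable G) (h : IndepFun U G P) {f : A × B → ℝ} (hf : Measurable f)
    (hi : Integrable (fun ω => f (U ω, G ω)) P) :
    ∫ ω, f (U ω, G ω) ∂P = ∫ ω, ∫ ω', f (U ω, G ω') ∂P ∂P := by
  rw [← integral_map (f := f) (hU.prodMk hG).aemeasurable hf.aestronglyMeasurable,
    h.map_prod_eq hU hG, integral_map (by fun_prop) hf.aestronglyMeasurable,
    integral_prod _ ((h.integrable_comp_iff hU hG hf).1 hi)]

end Transfer

/-- Differentiation under the integral sign on a set, for uniformly Lipschitz functions. -/
lemma hasDerivWithinAt_integral_of_lipschitz {Ω : Type*} [MeasurableSpace Ω] {P : Measure Ω}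
    [IsFiniteMeasure P] {F : Ω → ℝ → ℝ} {F' : Ω → ℝ} {S : Set ℝ} {t C : ℝ} (ht : t ∈ S)
    (hint : ∀ s ∈ S, Integrable (fun ω => F ω s) P)
    (hlip : ∀ᵐ ω ∂P, ∀ s ∈ S, |F ω s - F ω t| ≤ C * |s - t|)
    (hderiv : ∀ᵐ ω ∂P, HasDerivWithinAt (F ω) (F' ω) S t) :
    HasDerivWithinAt (fun s => ∫ ω, F ω s ∂P) (∫ ω, F' ω ∂P) S t := by
  rw [hasDerivWithinAt_iff_tendsto_slope]
  have hS : ∀ᶠ s in 𝓝[S \ {t}] t, s ∈ S \ {t} := self_mem_nhdsWithin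
  have hlim : Filter.Tendsto (fun s => ∫ ω, slope (F ω) t s ∂P) (𝓝[S \ {t}] t)
      (𝓝 (∫ ω, F' ω ∂P)) := by
    refine tendsto_integral_filter_of_dominated_convergence (fun _ => C) ?_ ?_
      (integrable_const C) ?_
    · filter_upwards [hS] with s hs
      simp only [slope_def_field]
      exact (((hint s hs.1).sub (hint t ht)).div_const _).aestronglyMeasurable
    · filter_upwards [hS] with s hs
      filter_upwards [hlip] with ω hω
      have hst : 0 < |s - t| := abs_pos.2 (sub_ne_zero.2 hs.2)
      rw [slope_def_field, Real.norm_eq_abs, abs_div, div_le_iff₀ hst]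
      exact hω s hs.1
    · filter_upwards [hderiv] with ω hω
      exact hasDerivWithinAt_iff_tendsto_slope.1 hω
  refine hlim.congr' ?_
  filter_upwards [hS] with s hs
  simp only [slope_def_field]
  rw [integral_div, integral_sub (hint s hs.1) (hint t ht)]

/-- The weights enter the bound only through their total mass; this is the purpose of the hypothesis
that the mass is at least one. -/
lemma GaussianPair.lintegral_log_le {Ω X : Type*} [MeasurableSpace Ω] [Countable X]
    {P : Measure Ω} {g₁ g₂ : X → Ω → ℝ} {D : X → X → ℝ} {d K V : ℝ} {w : X → ℝ}
    (hg : GaussianPair P g₁ g₂ D d K V) (hw : ∀ x, 0 < w x)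
    (hws : Summable w) (hw1 : 1 ≤ ∑' x, w x) {t : ℝ} (ht : t ∈ Icc (0 : ℝ) 1) :
    ∫⁻ ω, ‖Real.log (∑' x, w x * Real.exp (mix t (g₁ x ω) (g₂ x ω)))‖ₑ ∂P ≤
      ENNReal.ofReal ((∑' x, w x) * (2 * Real.exp (2 * V))) := by
  refine (lintegral_mono_ae ?_).trans (hg.lintegral_tsum_exp_le hw hws)
  filter_upwards [hg.ae_summable_exp hw hws] with ω hω
  rw [← ENNReal.ofReal_tsum_of_nonneg (fun x => (mul_pos (hw x) (Real.exp_pos _)).le) hω,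
    Real.enorm_eq_ofReal_abs]
  exact ENNReal.ofReal_le_ofReal
    (abs_log_tsum_exp_le (fun x => (hw x).le) hws hw1 (fun x => abs_mix_le ht _ _) hω)

/-! ### The model as a functional of separate weights and fields -/

section Model

variable {Ω : Type*} {N k : ℕ} {H : SpinConfig N → Ω → ℝ}
  {u : (l : Fin k) → (Fin l → ℕ) → ℕ → Ω → ℝ}
  {z : (l : Fin (k + 1)) → (Fin l → ℕ) → Fin N → Ω → ℝ}

lemma cascadeWeight_pos {ω : Ω} (hpos : ∀ α, 0 < cascadeProd u α ω)
    (hsum : 0 < ∑' α, cascadeProd u α ω) (x : SpinConfig N × (Fin k → ℕ)) :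
    0 < cascadeWeight u x.2 ω :=
  div_pos (hpos _) hsum

lemma summable_cascadeWeight {ω : Ω} (hpos : ∀ α, 0 < cascadeProd u α ω)
    (hs : Summable fun α => cascadeProd u α ω) (hsum : 0 < ∑' α, cascadeProd u α ω) :
    Summable fun x : SpinConfig N × (Fin k → ℕ) => cascadeWeight u x.2 ω := by
  have h := Summable.mul_of_nonneg (f := fun _ : SpinConfig N => (1 : ℝ))
    (g := fun α => cascadeWeight u α ω) (hasSum_fintype _).summable (hs.div_const _)
    (fun _ => zero_le_one) fun α => (div_pos (hpos α) hsum).le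
  simpa using h

/-- Normalization makes the mass deterministic, so bounds that depend on it are uniform over the
cascade. -/
lemma tsum_cascadeWeight {ω : Ω} (hpos : ∀ α, 0 < cascadeProd u α ω)
    (hs : Summable fun α => cascadeProd u α ω) (hsum : 0 < ∑' α, cascadeProd u α ω) :
    ∑' x : SpinConfig N × (Fin k → ℕ), cascadeWeight u x.2 ω = Fintype.card (SpinConfig N) := by
  have hw : Summable fun α => cascadeWeight u α ω := hs.div_const _
  have h1 : ∑' α, cascadeWeight u α ω = 1 := by
    simp only [cascadeWeight]
    rw [tsum_div_const, div_self hsum.ne']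
  have h := (hasSum_fintype fun _ : SpinConfig N => (1 : ℝ)).summable.tsum_mul_tsum hw
    (by simpa using summable_cascadeWeight (N := N) hpos hs hsum)
  rw [h1, tsum_fintype] at h
  simpa using h.symm

variable [MeasurableSpace Ω]

lemma measurable_boltzmannWeight (hH : ∀ σ, Measurable (H σ)) (hu : ∀ l a n, Measurable (u l a n))
    (hz : ∀ l a i, Measurable (z l a i)) (t : ℝ) (x : SpinConfig N × (Fin k → ℕ)) :
    Measurable (boltzmannWeight H u z t x) := by
  have hp : ∀ α : Fin k → ℕ, Measurable (cascadeProd u α) := fun α => by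
    unfold cascadeProd; fun_prop
  have hs : Measurable fun ω => ∑' α, cascadeProd u α ω := Measurable.tsum hp
  have hi : Measurable (interpHamiltonian H z t x.1 x.2) := by
    unfold interpHamiltonian pathSum; fun_prop
  unfold boltzmannWeight cascadeWeight
  fun_prop

lemma measurable_partitionFn (hH : ∀ σ, Measurable (H σ)) (hu : ∀ l a n, Measurable (u l a n))
    (hz : ∀ l a i, Measurable (z l a i)) (t : ℝ) : Measurable (partitionFn H u z t) := by
  unfold partitionFn
  exact Measurable.tsum fun x => measurable_boltzmannWeight hH hu hz t x

lemma measurable_gibbsAverage (hH : ∀ σ, Measurable (H σ)) (hu : ∀ l a n, Measurable (u l a n))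
    (hz : ∀ l a i, Measurable (z l a i)) (t : ℝ)
    (f : SpinConfig N × (Fin k → ℕ) → SpinConfig N × (Fin k → ℕ) → ℝ) :
    Measurable (gibbsAverage H u z t f) :=
  measurable_pairAverage fun x => measurable_boltzmannWeight hH hu hz t x

section Coordinates

/-- The space of all values of the random variables `u`. -/
abbrev CascadeSpace (k : ℕ) : Type := (l : Fin k) → (Fin l → ℕ) → ℕ → ℝ

/-- The space of all values of the random variables `(H, z)`. -/
abbrev FieldSpace (N k : ℕ) : Type :=
  (SpinConfig N → ℝ) × ((l : Fin (k + 1)) → (Fin l → ℕ) → Fin N → ℝ)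

/-- The coordinates of `H` on the product space. -/
def coordH (σ : SpinConfig N) (p : CascadeSpace k × FieldSpace N k) : ℝ := p.2.1 σ

/-- The coordinates of `u` on the product space. -/
def coordU (l : Fin k) (a : Fin l → ℕ) (n : ℕ) (p : CascadeSpace k × FieldSpace N k) : ℝ :=
  p.1 l a n

/-- The coordinates of `z` on the product space. -/
def coordZ (l : Fin (k + 1)) (a : Fin l → ℕ) (i : Fin N) (p : CascadeSpace k × FieldSpace N k) :
    ℝ := p.2.2 l a i

lemma measurable_coordH (σ : SpinConfig N) : Measurable (coordH (k := k) σ) := by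
  unfold coordH; fun_prop

lemma measurable_coordU (l : Fin k) (a : Fin l → ℕ) (n : ℕ) :
    Measurable (coordU (N := N) l a n) := by
  unfold coordU; fun_prop

lemma measurable_coordZ (l : Fin (k + 1)) (a : Fin l → ℕ) (i : Fin N) :
    Measurable (coordZ (k := k) l a i) := by
  unfold coordZ; fun_prop

omit [MeasurableSpace Ω]

/-- The random point with coordinates `u`. -/
def cascadePoint (u : (l : Fin k) → (Fin l → ℕ) → ℕ → Ω → ℝ) (ω : Ω) : CascadeSpace k :=
  fun l a n => u l a n ω

/-- The random point with coordinates `H` and `z`. -/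
def fieldPoint (H : SpinConfig N → Ω → ℝ) (z : (l : Fin (k + 1)) → (Fin l → ℕ) → Fin N → Ω → ℝ)
    (ω : Ω) : FieldSpace N k :=
  (fun σ => H σ ω, fun l a i => z l a i ω)

/-- Evaluated at the coordinates of two sample points, the weight has the cascade at `ω` and the
fields at `ω'`. That all these identities are definitional lets measurability on the canonical space
serve both readings. -/
lemma boltzmannWeight_coord (t : ℝ) (x : SpinConfig N × (Fin k → ℕ)) (ω ω' : Ω) :
    boltzmannWeight coordH coordU coordZ t x (cascadePoint u ω, fieldPoint H z ω') =
      cascadeWeight u x.2 ω * Real.exp (mix t (H x.1 ω') (treeField z x ω')) :=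
  rfl

lemma boltzmannWeight_coord_self (t : ℝ) (x : SpinConfig N × (Fin k → ℕ)) (ω : Ω) :
    boltzmannWeight coordH coordU coordZ t x (cascadePoint u ω, fieldPoint H z ω) =
      boltzmannWeight H u z t x ω :=
  rfl

lemma partitionFn_coord (t : ℝ) (ω ω' : Ω) :
    partitionFn coordH coordU coordZ t (cascadePoint u ω, fieldPoint H z ω') =
      ∑' x : SpinConfig N × (Fin k → ℕ),
        cascadeWeight u x.2 ω * Real.exp (mix t (H x.1 ω') (treeField z x ω')) :=
  rfl

lemma partitionFn_coord_self (t : ℝ) (ω : Ω) :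
    partitionFn coordH coordU coordZ t (cascadePoint u ω, fieldPoint H z ω) =
      partitionFn H u z t ω :=
  rfl

lemma gibbsAverage_coord_self (t : ℝ)
    (f : SpinConfig N × (Fin k → ℕ) → SpinConfig N × (Fin k → ℕ) → ℝ) (ω : Ω) :
    gibbsAverage coordH coordU coordZ t f (cascadePoint u ω, fieldPoint H z ω) =
      gibbsAverage H u z t f ω :=
  rfl

end Coordinates

end Model

/-- The weights are almost surely positive and summable, and they are independent of the pair of
Gaussian processes between which one interpolates. -/
structure IsCascadeModel {Ω : Type*} [MeasurableSpace Ω] (P : Measure Ω) {N k : ℕ} (ξ : ℝ → ℝ)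
    (q : ℕ → ℝ) (H : SpinConfig N → Ω → ℝ) (u : (l : Fin k) → (Fin l → ℕ) → ℕ → Ω → ℝ)
    (z : (l : Fin (k + 1)) → (Fin l → ℕ) → Fin N → Ω → ℝ) (K V : ℝ) : Prop where
  pair : GaussianPair P (fun x : SpinConfig N × (Fin k → ℕ) => H x.1) (treeField z)
    (covDiff ξ q) (-N * thetaFn ξ 1) K V
  measurable_H : ∀ σ, Measurable (H σ)
  measurable_u : ∀ l a n, Measurable (u l a n)
  measurable_z : ∀ l a i, Measurable (z l a i)
  indep : IndepFun (cascadePoint u) (fieldPoint H z) P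
  mass : ∀ᵐ ω ∂P, (∀ α, 0 < cascadeProd u α ω) ∧ Summable (fun α => cascadeProd u α ω) ∧
      0 < ∑' α, cascadeProd u α ω

/-! ### Averaging over the random weights -/

namespace IsCascadeModel

variable {Ω : Type*} [MeasurableSpace Ω] {P : Measure Ω} {N k : ℕ} {ξ : ℝ → ℝ} {q : ℕ → ℝ}
  {H : SpinConfig N → Ω → ℝ} {u : (l : Fin k) → (Fin l → ℕ) → ℕ → Ω → ℝ}
  {z : (l : Fin (k + 1)) → (Fin l → ℕ) → Fin N → Ω → ℝ} {K V t : ℝ}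

lemma measurable_cascadePoint (h : IsCascadeModel P ξ q H u z K V) :
    Measurable (cascadePoint u) := by
  have := h.measurable_u
  unfold cascadePoint; fun_prop

lemma measurable_fieldPoint (h : IsCascadeModel P ξ q H u z K V) :
    Measurable (fieldPoint H z) := by
  have := h.measurable_H
  have := h.measurable_z
  unfold fieldPoint; fun_prop

/-- The functional `log Z` on the product space is measurable. -/
lemma measurable_log_coord (N k : ℕ) (t : ℝ) :
    Measurable fun p => Real.log (partitionFn (N := N) (k := k) coordH coordU coordZ t p) :=
  (measurable_partitionFn measurable_coordH measurable_coordU measurable_coordZ t).log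

lemma measurable_gibbsAverage_coord (t : ℝ)
    (f : SpinConfig N × (Fin k → ℕ) → SpinConfig N × (Fin k → ℕ) → ℝ) :
    Measurable (gibbsAverage (N := N) (k := k) coordH coordU coordZ t f) :=
  measurable_gibbsAverage measurable_coordH measurable_coordU measurable_coordZ t f

/-- The total mass `2^N` of the weights `w_α` on the space of pairs `(σ, α)`, times a bound for the
exponential moments. -/
def massBound (N : ℕ) (V : ℝ) : ℝ≥0∞ :=
  ENNReal.ofReal (Fintype.card (SpinConfig N) * (2 * Real.exp (2 * V)))

lemma lintegral_le_massBound [IsProbabilityMeasure P] {f : Ω → ℝ≥0∞}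
    (hf : ∀ᵐ ω ∂P, f ω ≤ massBound N V) : ∫⁻ ω, f ω ∂P < ∞ := by
  refine (lintegral_mono_ae hf).trans_lt ?_
  rw [lintegral_const, measure_univ, mul_one]
  exact ENNReal.ofReal_lt_top

lemma lintegral_boltzmannWeight_lt_top [IsProbabilityMeasure P]
    (h : IsCascadeModel P ξ q H u z K V) (ht : t ∈ Icc (0 : ℝ) 1) :
    ∫⁻ ω, ∑' x, ENNReal.ofReal (boltzmannWeight H u z t x ω) ∂P < ∞ := by
  have hm : Measurable fun p : CascadeSpace k × FieldSpace N k =>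
      ∑' x, ENNReal.ofReal (boltzmannWeight coordH coordU coordZ t x p) :=
    Measurable.tsum fun x => (measurable_boltzmannWeight measurable_coordH measurable_coordU
      measurable_coordZ t x).ennreal_ofReal
  have h1 := h.indep.lintegral_eq h.measurable_cascadePoint h.measurable_fieldPoint hm
  simp only [boltzmannWeight_coord_self] at h1
  rw [h1]
  simp only [boltzmannWeight_coord]
  refine lintegral_le_massBound (N := N) (V := V) ?_
  filter_upwards [h.mass] with ω ⟨hp, hs, h0⟩
  have hw : ∀ x : SpinConfig N × (Fin k → ℕ), 0 < cascadeWeight u x.2 ω := cascadeWeight_pos hp h0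
  have h2 := h.pair.lintegral_tsum_exp_le hw (summable_cascadeWeight hp hs h0)
  rw [tsum_cascadeWeight hp hs h0] at h2
  refine (lintegral_mono fun ω' => ENNReal.tsum_le_tsum fun x => ?_).trans h2
  exact ENNReal.ofReal_le_ofReal (GaussianPair.exp_mix_le (g₁ := fun x : SpinConfig N × (Fin k → ℕ) => H x.1)
    (g₂ := treeField z) hw ht ω' x)

lemma ae_partitionFn_pos [IsProbabilityMeasure P]
    (h : IsCascadeModel P ξ q H u z K V) (ht : t ∈ Icc (0 : ℝ) 1) :
    ∀ᵐ ω ∂P, (∀ x, 0 < boltzmannWeight H u z t x ω) ∧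
      Summable (fun x => boltzmannWeight H u z t x ω) ∧ 0 < partitionFn H u z t ω := by
  have hmeas : Measurable fun ω => ∑' x, ENNReal.ofReal (boltzmannWeight H u z t x ω) :=
    Measurable.tsum fun x => (measurable_boltzmannWeight h.measurable_H h.measurable_u
      h.measurable_z t x).ennreal_ofReal
  filter_upwards [h.mass, ae_lt_top hmeas (h.lintegral_boltzmannWeight_lt_top ht).ne]
    with ω ⟨hp, hs, h0⟩ hω
  have hpos : ∀ x, 0 < boltzmannWeight H u z t x ω := fun x =>
    mul_pos (cascadeWeight_pos hp h0 x) (Real.exp_pos _)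
  have hsum : Summable fun x => boltzmannWeight H u z t x ω := by
    have := ENNReal.summable_toReal hω.ne
    simpa only [ENNReal.toReal_ofReal (hpos _).le] using this
  exact ⟨hpos, hsum, hsum.tsum_pos (fun x => (hpos x).le) (fun _ => 1, fun _ => 0) (hpos _)⟩

lemma integrable_gibbsAverage [IsProbabilityMeasure P]
    (h : IsCascadeModel P ξ q H u z K V) (ht : t ∈ Icc (0 : ℝ) 1)
    {f : SpinConfig N × (Fin k → ℕ) → SpinConfig N × (Fin k → ℕ) → ℝ} {C : ℝ}
    (hf : ∀ x y, |f x y| ≤ C) : Integrable (gibbsAverage H u z t f) P := by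
  refine (integrable_const C).mono' (measurable_gibbsAverage h.measurable_H h.measurable_u
    h.measurable_z t f).aestronglyMeasurable ?_
  filter_upwards [h.ae_partitionFn_pos ht] with ω ⟨hp, hs, h0⟩
  exact abs_pairAverage_le (fun x => (hp x).le) hs h0 hf

lemma integrable_log_partitionFn [IsProbabilityMeasure P]
    (h : IsCascadeModel P ξ q H u z K V) (ht : t ∈ Icc (0 : ℝ) 1) :
    Integrable (fun ω => Real.log (partitionFn H u z t ω)) P := by
  refine ⟨(measurable_partitionFn h.measurable_H h.measurable_u
    h.measurable_z t).log.aestronglyMeasurable, ?_⟩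
  have h1 := h.indep.lintegral_eq h.measurable_cascadePoint h.measurable_fieldPoint
    (measurable_log_coord N k t).enorm
  simp only [partitionFn_coord_self] at h1
  rw [HasFiniteIntegral, h1]
  simp only [partitionFn_coord]
  refine lintegral_le_massBound (N := N) (V := V) ?_
  filter_upwards [h.mass] with ω ⟨hp, hs, h0⟩
  have hw : ∀ x : SpinConfig N × (Fin k → ℕ), 0 < cascadeWeight u x.2 ω := cascadeWeight_pos hp h0
  have hmass := tsum_cascadeWeight (N := N) hp hs h0
  -- The number of spin configurations is the mass of the weights, so the mass is at least one.
  have hcard : 1 ≤ (Fintype.card (SpinConfig N) : ℝ) := by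
    exact_mod_cast Fintype.card_pos
  have h2 := h.pair.lintegral_log_le hw (summable_cascadeWeight hp hs h0)
    (hcard.trans_eq hmass.symm) ht
  rwa [hmass] at h2

/-- The expectation of `log Z` over the Gaussian processes, for fixed weights. -/
def fieldFreeEnergy (P : Measure Ω) (H : SpinConfig N → Ω → ℝ)
    (u : (l : Fin k) → (Fin l → ℕ) → ℕ → Ω → ℝ)
    (z : (l : Fin (k + 1)) → (Fin l → ℕ) → Fin N → Ω → ℝ) (ω : Ω) (t : ℝ) : ℝ :=
  ∫ ω', Real.log (∑' x : SpinConfig N × (Fin k → ℕ),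
    cascadeWeight u x.2 ω * Real.exp (mix t (H x.1 ω') (treeField z x ω'))) ∂P

/-- The expectation of a Gibbs average over the Gaussian processes, for fixed weights. -/
def fieldAverage (P : Measure Ω) (H : SpinConfig N → Ω → ℝ)
    (u : (l : Fin k) → (Fin l → ℕ) → ℕ → Ω → ℝ)
    (z : (l : Fin (k + 1)) → (Fin l → ℕ) → Fin N → Ω → ℝ) (t : ℝ)
    (f : SpinConfig N × (Fin k → ℕ) → SpinConfig N × (Fin k → ℕ) → ℝ) (ω : Ω) : ℝ :=
  ∫ ω', pairAverage (fun x : SpinConfig N × (Fin k → ℕ) =>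
    cascadeWeight u x.2 ω * Real.exp (mix t (H x.1 ω') (treeField z x ω'))) f ∂P

/-- Fubini for independent weights and fields, with the weights in the outer integral. -/
lemma cascadeInterpolation_eq [IsProbabilityMeasure P]
    (h : IsCascadeModel P ξ q H u z K V) (ht : t ∈ Icc (0 : ℝ) 1) :
    Integrable (fun ω => fieldFreeEnergy P H u z ω t) P ∧
      cascadeInterpolation H u z P t = (N : ℝ)⁻¹ * ∫ ω, fieldFreeEnergy P H u z ω t ∂P := by
  have hm := measurable_log_coord N k t
  have hi : Integrable (fun ω => Real.log (partitionFn coordH coordU coordZ t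
      (cascadePoint u ω, fieldPoint H z ω))) P := h.integrable_log_partitionFn ht
  have h1 := h.indep.integral_eq_integral_integral h.measurable_cascadePoint
    h.measurable_fieldPoint hm hi
  have h2 := ((h.indep.integrable_comp_iff h.measurable_cascadePoint
    h.measurable_fieldPoint hm).1 hi).integral_prod_left
  simp only [partitionFn_coord_self] at h1
  refine ⟨h2, ?_⟩
  rw [cascadeInterpolation, h1]
  rfl

lemma integral_gibbsAverage_eq [IsProbabilityMeasure P]
    (h : IsCascadeModel P ξ q H u z K V) (ht : t ∈ Icc (0 : ℝ) 1)
    {f : SpinConfig N × (Fin k → ℕ) → SpinConfig N × (Fin k → ℕ) → ℝ} {C : ℝ}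
    (hf : ∀ x y, |f x y| ≤ C) :
    Integrable (fieldAverage P H u z t f) P ∧
      ∫ ω, gibbsAverage H u z t f ω ∂P = ∫ ω, fieldAverage P H u z t f ω ∂P := by
  have hm := measurable_gibbsAverage_coord (N := N) (k := k) t f
  have hi : Integrable (fun ω => gibbsAverage coordH coordU coordZ t f
      (cascadePoint u ω, fieldPoint H z ω)) P := h.integrable_gibbsAverage ht hf
  have h1 := h.indep.integral_eq_integral_integral h.measurable_cascadePoint
    h.measurable_fieldPoint hm hi
  have h2 := ((h.indep.integrable_comp_iff h.measurable_cascadePoint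
    h.measurable_fieldPoint hm).1 hi).integral_prod_left
  simp only [gibbsAverage_coord_self] at h1
  refine ⟨h2, ?_⟩
  rw [h1]
  rfl

/-- The Lipschitz constant is the same for almost every realization of the weights, so the
derivative passes under the outer expectation without any moments of the cascade. -/
lemma hasDerivWithinAt_integral_fieldFreeEnergy [IsProbabilityMeasure P]
    (h : IsCascadeModel P ξ q H u z K V) (ht : t ∈ Icc (0 : ℝ) 1) :
    HasDerivWithinAt (fun s => ∫ ω, fieldFreeEnergy P H u z ω s ∂P)
      (∫ ω, (-N * thetaFn ξ 1 / 2 - (1 / 2) * fieldAverage P H u z t (covDiff ξ q) ω) ∂P)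
      (Icc 0 1) t := by
  refine hasDerivWithinAt_integral_of_lipschitz (C := |-N * thetaFn ξ 1| / 2 + K / 2) ht
    (fun s hs => (h.cascadeInterpolation_eq hs).1) ?_ ?_
  · filter_upwards [h.mass] with ω ⟨hp, hs, h0⟩ s hs'
    have hw : ∀ x : SpinConfig N × (Fin k → ℕ), 0 < cascadeWeight u x.2 ω :=
      cascadeWeight_pos hp h0
    exact h.pair.abs_integral_log_tsum_sub_le hw (summable_cascadeWeight hp hs h0) ht hs'
  · filter_upwards [h.mass] with ω ⟨hp, hs, h0⟩
    have hw : ∀ x : SpinConfig N × (Fin k → ℕ), 0 < cascadeWeight u x.2 ω :=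
      cascadeWeight_pos hp h0
    exact h.pair.hasDerivWithinAt_integral_log_tsum hw (summable_cascadeWeight hp hs h0) ht

theorem hasDerivWithinAt_cascadeInterpolation [IsProbabilityMeasure P] (hN : 1 ≤ N)
    (h : IsCascadeModel P ξ q H u z K V) (ht : t ∈ Icc (0 : ℝ) 1) :
    Integrable (gibbsAverage H u z t (fun x y => thetaFn ξ (q (treeMeet x.2 y.2)))) P ∧
    Integrable (gibbsAverage H u z t
      (fun x y => deltaFn ξ (overlap x.1 y.1) (q (treeMeet x.2 y.2)))) P ∧
    HasDerivWithinAt (cascadeInterpolation H u z P)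
      (-(1 / 2) * thetaFn ξ 1
        + (1 / 2) * ∫ ω, gibbsAverage H u z t
            (fun x y => thetaFn ξ (q (treeMeet x.2 y.2))) ω ∂P
        - (1 / 2) * ∫ ω, gibbsAverage H u z t
            (fun x y => deltaFn ξ (overlap x.1 y.1) (q (treeMeet x.2 y.2))) ω ∂P)
      (Icc 0 1) t := by
  obtain ⟨K₁, hK₁⟩ := exists_abs_le_of_overlap (N := N) (k := k) q fun _ b => thetaFn ξ b
  obtain ⟨K₂, hK₂⟩ := exists_abs_le_of_overlap (N := N) (k := k) q fun a b => deltaFn ξ a b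
  have hi₁ := h.integrable_gibbsAverage ht hK₁
  have hi₂ := h.integrable_gibbsAverage ht hK₂
  refine ⟨hi₁, hi₂, ?_⟩
  have hfinal := ((h.hasDerivWithinAt_integral_fieldFreeEnergy ht).const_mul (N : ℝ)⁻¹).congr
    (fun s hs => (h.cascadeInterpolation_eq hs).2) (h.cascadeInterpolation_eq ht).2
  refine hfinal.congr_deriv ?_
  obtain ⟨hcint, hceq⟩ := h.integral_gibbsAverage_eq ht h.pair.bound
  -- The factor `N` taken out here cancels the normalization of the free energy.
  have hlin : ∫ ω, gibbsAverage H u z t (covDiff ξ q) ω ∂P = N * (∫ ω, gibbsAverage H u z t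
        (fun x y => deltaFn ξ (overlap x.1 y.1) (q (treeMeet x.2 y.2))) ω ∂P -
      ∫ ω, gibbsAverage H u z t (fun x y => thetaFn ξ (q (treeMeet x.2 y.2))) ω ∂P) := by
    rw [← integral_sub hi₂ hi₁, ← integral_const_mul]
    refine integral_congr_ae ?_
    filter_upwards [h.ae_partitionFn_pos ht] with ω ⟨hp, hs, h0⟩
    exact pairAverage_const_mul_sub (fun x => (hp x).le) hs hK₂ hK₁ N
  rw [integral_sub (integrable_const _) (hcint.const_mul _), integral_const_mul, ← hceq, hlin]
  have hN0 : (N : ℝ) ≠ 0 := by positivity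
  simp only [integral_const, probReal_univ, smul_eq_mul, one_mul]
  field_simp
  ring

end IsCascadeModel

end

theorem mainTheorem8 {Ω : Type*} [MeasurableSpace Ω] (P : Measure Ω) [IsProbabilityMeasure P]
    (N k : ℕ) (hN : 1 ≤ N) (hk : 1 ≤ k)
    (ξ : ℝ → ℝ) (hξ_smooth : ContDiff ℝ ((⊤ : ℕ∞) : WithTop ℕ∞) ξ) (hξ_convex : ConvexOn ℝ Set.univ ξ)
    (hξ_zero : ξ 0 = 0) (hξ_deriv_zero : deriv ξ 0 = 0)
    (m q : ℕ → ℝ)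
    (hm_zero : m 0 = 0) (hm_lt : ∀ l < k, m l < m (l + 1)) (hm_last : m k < 1)
    (hq_zero : q 0 = 0) (hq_lt : ∀ l ≤ k, q l < q (l + 1)) (hq_last : q (k + 1) = 1)
    (H : SpinConfig N → Ω → ℝ)
    (u : (l : Fin k) → (Fin l → ℕ) → ℕ → Ω → ℝ)
    (z : (l : Fin (k + 1)) → (Fin l → ℕ) → Fin N → Ω → ℝ)
    (hH : IsGaussianHamiltonian P ξ H)
    (hu : IsCascade P m u)
    (hz : IsTreeGaussian P ξ q z)
    (hH_indep : IndepFun (fun ω σ => H σ ω)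
      (fun ω => ((fun l a n => u l a n ω), (fun l a i => z l a i ω))) P)
    (hu_indep : IndepFun (fun ω l a n => u l a n ω) (fun ω l a i => z l a i ω) P) :
    (∀ᵐ ω ∂P, Summable (fun α => cascadeProd u α ω) ∧ 0 < ∑' α, cascadeProd u α ω) ∧
    ∀ t ∈ Set.Icc (0 : ℝ) 1,
      (∀ᵐ ω ∂P, Summable (fun x => boltzmannWeight H u z t x ω) ∧
        0 < partitionFn H u z t ω) ∧
      Integrable (fun ω => Real.log (partitionFn H u z t ω)) P ∧
      Integrable (gibbsAverage H u z t
        (fun x y => thetaFn ξ (q (treeMeet x.2 y.2)))) P ∧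
      Integrable (gibbsAverage H u z t
        (fun x y => deltaFn ξ (overlap x.1 y.1) (q (treeMeet x.2 y.2)))) P ∧
      HasDerivWithinAt (cascadeInterpolation H u z P)
        (-(1 / 2) * thetaFn ξ 1
          + (1 / 2) * ∫ ω, gibbsAverage H u z t
              (fun x y => thetaFn ξ (q (treeMeet x.2 y.2))) ω ∂P
          - (1 / 2) * ∫ ω, gibbsAverage H u z t
              (fun x y => deltaFn ξ (overlap x.1 y.1) (q (treeMeet x.2 y.2))) ω ∂P)
        (Set.Icc 0 1) t := by
  -- Convexity of `ξ` makes the variances of the tree variables nonnegative.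
  have hqk : ∀ l ≤ k, deriv ξ (q l) ≤ deriv ξ (q (l + 1)) := fun l hl =>
    hξ_convex.monotoneOn_deriv (fun x _ => hξ_smooth.differentiable (by simp) x)
      (mem_univ _) (mem_univ _) (hq_lt l hl).le
  have hHz : IndepFun (fun ω σ => H σ ω) (fun ω l a i => z l a i ω) P :=
    hH_indep.comp measurable_id measurable_snd
  have hmass := hu.ae_summable hm_zero hm_lt hm_last
  obtain ⟨K, V, hpair⟩ := exists_gaussianPair hN hH hz hHz hqk (by rw [hq_zero, hξ_deriv_zero])
    hq_last
  have hHm := hH.measurable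
  have hum := hu.measurable
  have hzm := hz.measurable
  have hmodel : IsCascadeModel P ξ q H u z K V :=
    { pair := hpair
      measurable_H := hHm
      measurable_u := hum
      measurable_z := hzm
      indep := hH_indep.prodMk_of_indepFun (by fun_prop) (by unfold cascadePoint; fun_prop)
        (by fun_prop) hu_indep
      mass := hmass }
  refine ⟨hmass.mono fun ω h => h.2, fun t ht => ?_⟩
  obtain ⟨h₁, h₂, h₃⟩ := hmodel.hasDerivWithinAt_cascadeInterpolation hN ht
  exact ⟨(hmodel.ae_partitionFn_pos ht).mono fun ω h => h.2,
    hmodel.integrable_log_partitionFn ht, h₁, h₂, h₃⟩
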